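/- Let $(M,g)$ be a smooth, oriented, compact $m$-dimensional Riemannian manifold (possibly with boundary or corners). Let $M_A$ be a compact, oriented, polygonal Riemannian $m$-manifold: the space of a finite geometric simplicial complex whose maximal simplices (facets) are $m$-dimensional, each facet carrying an orientation and a Riemannian metric $g_A$ that is smooth up to its boundary. Let $\varphi_A\colon M_A\to M$ be an orientation-preserving diffeomorphism, i.e. a bijection which on each closed facet is smooth with invertible, orientation-preserving tangent maps. For $0\le k\le m$ let $L^2\Omega^k(M)$ and $L^2\Omega^k(M_A)$ be the Hilbert spaces of (almost everywhere equal classes of) measurable square-integrable $k$-forms, with inner product $\langle u,v\rangle=\int \langle\!\langle u,v\rangle\!\rangle\,\mu$, where $\langle\!\langle\cdot,\cdot\rangle\!\rangle$ is the pointwise inner product induced by the metric and $\mu$ is the Riemannian volume. Let $\star_M$ and $\star_{M_A}$ be the Hodge star operators, determined by $u\wedge\star v=\langle\!\langle u,v\rangle\!\rangle\,\mu$, let $\pi_A=\varphi_A^*$ be the pull-back of forms from $M$ to $M_A$, and let $i_A=\varphi_{A*}=(\varphi_A^{-1})^*$ be the push-forward of forms from $M_A$ to $M$. Then $i_A\colon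 L^2\Omega^k(M_A)\to L^2\Omega^k(M)$ is bounded, and its adjoint $i_A^*\colon L^2\Omega^k(M)\to L^2\Omega^k(M_A)$, defined by $\langle i_A^*\tau,\sigma\rangle_{M_A}=\langle\tau,i_A\sigma\rangle_M$ for all $\sigma\in L^2\Omega^k(M_A)$, is given by $$i_A^*\tau=(-1)^{k(m-k)}\star_{M_A}\pi_A\star_M\tau\qquad\text{for every }\tau\in L^2\Omega^k(M).$$ -/

import Mathlib

open MeasureTheory Set Filter Topology Bundle
open scoped Manifold ContDiff

noncomputable section

namespace HodgeAdjoint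

/-! ### Exterior algebra of an oriented inner product space

The inner product is given as a function `B : W → W → ℝ`, and everything is computed in a basis
`b` of `W`, which need not be orthonormal; none of the results depends on the choice of `b`. -/

lemma append_update_cast {W : Type*} {m k l : ℕ} (h : k + l = m) (u : Fin k → W) (v : Fin l → W) (i : Fin l) (z : W) :
    (fun j => Fin.append u (Function.update v i z) (Fin.cast h.symm j)) =
      Function.update (fun j => Fin.append u v (Fin.cast h.symm j))
        (Fin.cast h (Fin.natAdd k i)) z := by
  subst h
  funext j
  refine Fin.addCases (fun a => ?_) (fun a => ?_) j
  · have : Fin.castAdd l a ≠ Fin.natAdd k i := by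
      intro h'
      have h1 := congrArg Fin.val h'
      have h2 := a.2
      simp only [Fin.val_castAdd, Fin.val_natAdd] at h1
      omega
    simp [Function.update_of_ne this]
  · by_cases hai : a = i
    · subst hai
      simp
    · have : Fin.natAdd k a ≠ Fin.natAdd k i := by simpa using hai
      simp [Function.update_of_ne this, Function.update_of_ne hai]

section Pointwise

variable {W : Type*} [AddCommGroup W] [Module ℝ W] {m k l : ℕ}

/-- The Gram matrix `G i j = B (b i) (b j)`. -/
def gram (b : Fin m → W) (B : W → W → ℝ) : Matrix (Fin m) (Fin m) ℝ :=
  Matrix.of fun i j => B (b i) (b j)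

/-- The entry `G^{I₁J₁} ⋯ G^{IₖJₖ}` of the metric on covariant `k`-tensors, where `G^{ij}` are the
entries of the inverse Gram matrix. -/
def dualGram (b : Fin m → W) (B : W → W → ℝ) (I J : Fin k → Fin m) : ℝ :=
  ∏ a, (gram b B)⁻¹ (I a) (J a)

/-- The inner product `⟪α, β⟫ = (1 / k!) ∑ G^{I₁J₁} ⋯ G^{IₖJₖ} α_I β_J` of two alternating
`k`-forms. If `b` is orthonormal this is the sum of `α_I β_I` over increasing `I`. -/
def formInner (b : Module.Basis (Fin m) ℝ W) (B : W → W → ℝ) (α β : W [⋀^Fin k]→ₗ[ℝ] ℝ) : ℝ :=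
  ((k.factorial : ℝ))⁻¹ * ∑ I : Fin k → Fin m, ∑ J : Fin k → Fin m,
    dualGram b B I J * α (b ∘ I) * β (b ∘ J)

/-- The family `v` of `m` vectors is a positively oriented basis. -/
def PosOriented (o : Orientation ℝ W (Fin m)) (v : Fin m → W) : Prop :=
  0 < Module.Ray.someVector o v

open scoped Classical in
/-- The volume form `± √(det G) b¹ ∧ ⋯ ∧ bᵐ`: the alternating `m`-form whose value on positively
oriented orthonormal bases is `1`. -/
def volForm (b : Module.Basis (Fin m) ℝ W) (B : W → W → ℝ) (o : Orientation ℝ W (Fin m)) :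
    W [⋀^Fin m]→ₗ[ℝ] ℝ :=
  ((if PosOriented o b then 1 else -1) * Real.sqrt (gram b B).det) • b.det

/-- The `l`-form `v ↦ w (u₁, …, uₖ, v₁, …, vₗ)`. -/
def contract (h : k + l = m) (w : W [⋀^Fin m]→ₗ[ℝ] ℝ) (u : Fin k → W) :
    W [⋀^Fin l]→ₗ[ℝ] ℝ where
  toFun v := w fun i => Fin.append u v (Fin.cast h.symm i)
  map_update_add' := by
    intro inst v i x y
    obtain rfl : inst = instDecidableEqFin l := Subsingleton.elim _ _
    have key := append_update_cast h u v i
    change w _ = w _ + w _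
    rw [key, key, key, w.map_update_add]
  map_update_smul' := by
    intro inst v i c x
    obtain rfl : inst = instDecidableEqFin l := Subsingleton.elim _ _
    have key := append_update_cast h u v i
    change w _ = c • w _
    rw [key, key, w.map_update_smul]
  map_eq_zero_of_eq' := by
    intro v i j hv hij
    subst h
    exact w.map_eq_zero_of_eq _ (i := Fin.natAdd k i) (j := Fin.natAdd k j) (by simp [hv])
      (by simpa using hij)

/-- The Hodge star of a `k`-form: the `(m - k)`-form
`(⋆β)(v) = (1 / k!) ∑ G^{I₁J₁} ⋯ G^{IₖJₖ} β_I vol (b_{J₁}, …, b_{Jₖ}, v)`, which is the form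
with `α ∧ ⋆β = ⟪α, β⟫ vol` for every `k`-form `α`. -/
def hodgeStar (b : Module.Basis (Fin m) ℝ W) (B : W → W → ℝ) (o : Orientation ℝ W (Fin m))
    (h : k + l = m) (β : W [⋀^Fin k]→ₗ[ℝ] ℝ) : W [⋀^Fin l]→ₗ[ℝ] ℝ :=
  ((k.factorial : ℝ))⁻¹ • ∑ I : Fin k → Fin m, ∑ J : Fin k → Fin m,
    (dualGram b B I J * β (b ∘ I)) • contract h (volForm b B o) (b ∘ J)

end Pointwise

/-- The coordinate space `ℝᵐ`. -/
abbrev Coord (m : ℕ) : Type := EuclideanSpace ℝ (Fin m)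

/-- The standard basis of `ℝᵐ`. -/
def stdBasis (m : ℕ) : Module.Basis (Fin m) ℝ (Coord m) :=
  (EuclideanSpace.basisFun (Fin m) ℝ).toBasis

/-! ### `L²` forms on a smooth Riemannian manifold (possibly with boundary or corners) -/

section Manifold

variable {m k l : ℕ} {H : Type*} [TopologicalSpace H] (I : ModelWithCorners ℝ (Coord m) H)
  {M : Type*} [TopologicalSpace M] [ChartedSpace H M]

/-- A basis of the tangent space at `x` (in Mathlib the tangent space is a copy of `ℝᵐ`). -/
def tangentBasis (x : M) : Module.Basis (Fin m) ℝ (TangentSpace I x) :=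
  stdBasis m

variable (M) in
/-- Differential `k`-forms on `M`, without any regularity. -/
abbrev Form (k : ℕ) : Type _ := ∀ x : M, TangentSpace I x [⋀^Fin k]→ₗ[ℝ] ℝ

/-- The coordinate vector fields `∂/∂y₁, …, ∂/∂yₘ` of the chart around `x₀`, at the point with
coordinates `y`. -/
def coordFrame (x₀ : M) (y : Coord m) (i : Fin m) :
    TangentSpace I ((extChartAt I x₀).symm y) :=
  mfderivWithin 𝓘(ℝ, Coord m) I (extChartAt I x₀).symm (range I) y (stdBasis m i)

/-- A choice of orientations of the tangent spaces is continuous if, for the coordinate frame of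
each chart, being positively oriented is a locally constant property. -/
def IsContinuousOrientation (o : ∀ x : M, Orientation ℝ (TangentSpace I x) (Fin m)) : Prop :=
  ∀ x₀ : M, ∀ y ∈ (extChartAt I x₀).target, ∀ᶠ z in 𝓝[(extChartAt I x₀).target] y,
    (PosOriented (o ((extChartAt I x₀).symm z)) (coordFrame I x₀ z) ↔
      PosOriented (o ((extChartAt I x₀).symm y)) (coordFrame I x₀ y))

/-- A form is measurable if its components in every chart are (almost everywhere) measurable. -/
def IsMeasurableForm (w : Form I M k) : Prop :=
  ∀ x₀ : M, ∀ J : Fin k → Fin m,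
    AEMeasurable (fun y => w ((extChartAt I x₀).symm y) (coordFrame I x₀ y ∘ J))
      (volume.restrict (extChartAt I x₀).target)

section Metric

variable [IsManifold I ∞ M]
  (g : ContMDiffRiemannianMetric I ∞ (Coord m) (fun x : M => TangentSpace I x))

/-- The metric at `x`, as a function of two tangent vectors. -/
def metricAt (x : M) (v w : TangentSpace I x) : ℝ := g.inner x v w

/-- The measure `√(det g) dy` on the chart around `x₀`, extended by zero to `M`. -/
def chartVolume [MeasurableSpace M] (x₀ : M) : Measure M :=
  ((volume.restrict (extChartAt I x₀).target).withDensity fun y =>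
    ENNReal.ofReal (Real.sqrt (gram (coordFrame I x₀ y)
      (metricAt I g ((extChartAt I x₀).symm y))).det)).map (extChartAt I x₀).symm

/-- The Riemannian volume measure. The measures `√(det g) dy` of the different charts agree on
overlaps, and their least upper bound is the measure that is equal to each of them on the domain of
the chart. -/
def riemannianVolume [MeasurableSpace M] : Measure M :=
  ⨆ x₀ : M, chartVolume I g x₀

/-- The pointwise inner product of two forms. -/
def pointwiseInner (u v : Form I M k) (x : M) : ℝ :=
  formInner (tangentBasis I x) (metricAt I g x) (u x) (v x)

/-- The form is measurable and square integrable, that is, represents an element of `L²Ωᵏ(M)`.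
Two forms represent the same element if they agree almost everywhere. -/
def MemL2 [MeasurableSpace M] (w : Form I M k) : Prop :=
  IsMeasurableForm I w ∧ Integrable (pointwiseInner I g w w) (riemannianVolume I g)

/-- The `L²` inner product of two forms. -/
def l2Inner [MeasurableSpace M] (u v : Form I M k) : ℝ :=
  ∫ x, pointwiseInner I g u v x ∂(riemannianVolume I g)

/-- The Hodge star operator of `M`. -/
def star (o : ∀ x : M, Orientation ℝ (TangentSpace I x) (Fin m)) (h : k + l = m)
    (w : Form I M k) : Form I M l :=
  fun x => hodgeStar (tangentBasis I x) (metricAt I g x) (o x) h (w x)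

end Metric

end Manifold

/-! ### Polygonal Riemannian manifolds -/

/-- The standard simplex `{t ∈ ℝᵐ | tᵢ ≥ 0, ∑ tᵢ ≤ 1}`. -/
def simplex (m : ℕ) : Set (Coord m) :=
  {t | (∀ i, 0 ≤ t i) ∧ ∑ i, t i ≤ 1}

/-- A compact `m`-dimensional polygonal space in a real vector space `V`: a finite geometric
simplicial complex all of whose maximal simplices are `m`-dimensional, where each of these carries
a smooth Riemannian metric and an orientation. The metric need not be continuous across the common
faces of two simplices, and need not be induced by a metric on `V`. (That the space is a manifold,
and that the orientations of the simplices fit together, will follow from the existence of an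
orientation preserving diffeomorphism to an oriented manifold.)

An enumeration of the vertices of a facet provides affine coordinates in `simplex m` on it. The
metric and the orientation are given in these coordinates. -/
structure PolygonalSpace (m : ℕ) (V : Type*) [AddCommGroup V] [Module ℝ V] where
  /-- the simplicial complex -/
  complex : Geometry.SimplicialComplex ℝ V
  finite_faces : complex.faces.Finite
  /-- the enumerations of the vertices of the facets -/
  vertex (s : complex.facets) : Fin (m + 1) ≃ {v : V // v ∈ s.1}
  /-- the metric -/
  metric (s : complex.facets) (t : Coord m) : Coord m →ₗ[ℝ] Coord m →ₗ[ℝ] ℝ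
  metric_symm : ∀ s, ∀ t ∈ simplex m, ∀ v w, metric s t v w = metric s t w v
  metric_pos : ∀ s, ∀ t ∈ simplex m, ∀ v, v ≠ 0 → 0 < metric s t v v
  metric_smooth : ∀ s v w, ContDiffOn ℝ ∞ (fun t => metric s t v w) (simplex m)
  /-- the orientations of the facets -/
  orientation (s : complex.facets) : Orientation ℝ (Coord m) (Fin m)

namespace PolygonalSpace

variable {m k l : ℕ} {V : Type*} [AddCommGroup V] [Module ℝ V] (A : PolygonalSpace m V)

/-- The facets. -/
abbrev Facet : Type _ := A.complex.facets

instance : Finite A.Facet :=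
  (A.finite_faces.subset Geometry.SimplicialComplex.facets_subset).to_subtype

instance : Fintype A.Facet := Fintype.ofFinite _

/-- The affine parametrization `t ↦ p₀ + ∑ tᵢ (pᵢ - p₀)` of the facet with vertices
`p₀, …, pₘ`, for `t ∈ simplex m`. -/
def param (s : A.Facet) (t : Coord m) : V :=
  (A.vertex s 0 : V) + ∑ i : Fin m, t i • ((A.vertex s i.succ : V) - (A.vertex s 0 : V))

/-- Differential `k`-forms on the facets, without any regularity, in the affine coordinates; only
the values at `t ∈ simplex m` matter. -/
abbrev Form (k : ℕ) : Type _ := A.Facet → Coord m → Coord m [⋀^Fin k]→ₗ[ℝ] ℝ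

/-- The metric at a point, as a function of two vectors. -/
def metricAt (s : A.Facet) (t v w : Coord m) : ℝ := A.metric s t v w

/-- The Riemannian volume measure `√(det g) dt` of a facet. -/
def facetVolume (s : A.Facet) : Measure (Coord m) :=
  (volume.restrict (simplex m)).withDensity fun t =>
    ENNReal.ofReal (Real.sqrt (gram (stdBasis m) (A.metricAt s t)).det)

/-- The pointwise inner product of two forms. -/
def pointwiseInner (u v : A.Form k) (s : A.Facet) (t : Coord m) : ℝ :=
  formInner (stdBasis m) (A.metricAt s t) (u s t) (v s t)

/-- The form is measurable and square integrable, that is, represents an element of `L²Ωᵏ` of the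
polygonal space. -/
def MemL2 (σ : A.Form k) : Prop :=
  ∀ s, (∀ J : Fin k → Fin m,
      AEMeasurable (fun t => σ s t (stdBasis m ∘ J)) (volume.restrict (simplex m))) ∧
    Integrable (A.pointwiseInner σ σ s) (A.facetVolume s)

/-- Almost everywhere equality, that is, equality in `L²Ωᵏ` of the polygonal space. -/
def AEEq (σ ρ : A.Form k) : Prop :=
  ∀ s, σ s =ᵐ[A.facetVolume s] ρ s

/-- The `L²` inner product of two forms. -/
def l2Inner (u v : A.Form k) : ℝ :=
  ∑ s, ∫ t, A.pointwiseInner u v s t ∂(A.facetVolume s)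

/-- The Hodge star operator of the polygonal space. -/
def star (h : k + l = m) (σ : A.Form k) : A.Form l :=
  fun s t => hodgeStar (stdBasis m) (A.metricAt s t) (A.orientation s) h (σ s t)

section Map

variable {H : Type*} [TopologicalSpace H] (I : ModelWithCorners ℝ (Coord m) H)
  {M : Type*} [TopologicalSpace M] [ChartedSpace H M] (φ : V → M)

/-- The map `φ` in the affine coordinates of a facet. -/
def localMap (s : A.Facet) (t : Coord m) : M := φ (A.param s t)

/-- The tangent map of `φ`, at a point of a facet. -/
def tangentMap (s : A.Facet) (t : Coord m) : Coord m →L[ℝ] TangentSpace I (A.localMap φ s t) :=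
  mfderivWithin 𝓘(ℝ, Coord m) I (A.localMap φ s) (simplex m) t

/-- The map `φ` restricts to an orientation preserving diffeomorphism from the polygonal space to
the manifold `M` with orientation `o`: it is a bijection which on each (closed) facet is smooth,
with an invertible tangent map that preserves the orientation. (As the space is a finite union of
closed facets, such a map is a homeomorphism to `M` if `M` is Hausdorff.) -/
structure IsOrientedDiffeo (o : ∀ x : M, Orientation ℝ (TangentSpace I x) (Fin m)) : Prop where
  bijOn : BijOn φ A.complex.space univ
  smooth : ∀ s, ContMDiffOn 𝓘(ℝ, Coord m) I ∞ (A.localMap φ s) (simplex m)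
  bijective : ∀ s, ∀ t ∈ simplex m, Function.Bijective (A.tangentMap I φ s t)
  orientation : ∀ s, ∀ t ∈ simplex m, ∀ v : Fin m → Coord m,
    PosOriented (A.orientation s) v ↔
      PosOriented (o (A.localMap φ s t)) (fun i => A.tangentMap I φ s t (v i))

/-- The pull-back `π_A = φ^*` of forms on `M`. -/
def pullback (w : HodgeAdjoint.Form I M k) : A.Form k :=
  fun s t => (w (A.localMap φ s t)).compLinearMap (A.tangentMap I φ s t).toLinearMap

open scoped Classical in
/-- The push-forward `i_A = φ_* = (φ⁻¹)^*` of forms on the polygonal space: at the image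
`y = φ(x)` of a point `x` in the interior of a facet, it is `σ_x` composed with the inverse of the
tangent map at `x` (such an `x` is unique). At the other points of `M`, which form a null set, it is `0`. -/
def pushforward (σ : A.Form k) : HodgeAdjoint.Form I M k :=
  fun y =>
    if h : ∃ p : A.Facet × Coord m, p.2 ∈ interior (simplex m) ∧ A.localMap φ p.1 p.2 = y then
      (σ h.choose.1 h.choose.2).compLinearMap
        (A.tangentMap I φ h.choose.1 h.choose.2).inverse.toLinearMap
    else 0

/-- `ρ` represents the image of `τ` under the adjoint `i_A^* : L²Ωᵏ(M) → L²Ωᵏ(M_A)` of the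
push-forward: `⟨ρ, σ⟩ = ⟨τ, i_A σ⟩` for every `σ` in `L²Ωᵏ(M_A)`. -/
def IsAdjointImage [IsManifold I ∞ M] [MeasurableSpace M]
    (g : ContMDiffRiemannianMetric I ∞ (Coord m) (fun x : M => TangentSpace I x))
    (τ : HodgeAdjoint.Form I M k) (ρ : A.Form k) : Prop :=
  A.MemL2 ρ ∧ ∀ σ : A.Form k, A.MemL2 σ →
    A.l2Inner ρ σ = HodgeAdjoint.l2Inner I g τ (A.pushforward I φ σ)

end Map

end PolygonalSpace

end HodgeAdjoint

end

/-! Everything is transported to the facets, where the claim becomes linear algebra at each point.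
Write `P = φ^*g` for the metric pulled back to a facet (`pullMetric`). The Riemannian volume of `M`
is the sum over the facets of the images of the volumes of `P` (`riemannianVolume_eq_sum`): in a
chart this is the change of variables formula, and the images of the facet boundaries are null.
Since `φ^* i_A σ = σ` on open simplices, `⟨τ, i_A σ⟩` is the sum over the facets of `∫ ⟪φ^*τ, σ⟫_P
vol_P` (`l2Inner_pushforward`). As the tangent maps preserve orientation, `φ^* ⋆_M τ = ⋆_P φ^*τ`
(`pullback_star`).

What remains concerns two inner products `B`, `B'` on one oriented vector space. In terms of wedge
products, `⟪⋆γ, σ⟫ vol = γ ∧ σ` whatever the metric is (`formInner_hodgeStar_mul_sqrt`), while `⋆'β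
∧ σ = (-1)^(kl) ⟪β, σ⟫' vol'` (`sum_hodgeStar_mul_det`). Taking `γ = ⋆'β` gives `(-1)^(kl) ⟪⋆⋆'β, σ⟫
vol = ⟪β, σ⟫' vol'` (`formInner_hodgeStar_hodgeStar`), which is integrated with `B = g_A` and `B' =
P`.

Boundedness of the push-forward follows from compactness: both metrics are continuous on the closed
simplex, so their weighted norms on forms are uniformly comparable (`exists_formInner_le`). The same
comparison puts the candidate for the adjoint in `L²` (`memL2_star_pullback_star`). Uniqueness is
positive definiteness of the `L²` inner product (`IsAdjointImage.aeEq`). -/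

noncomputable section

namespace HodgeAdjoint

/-! ### Kronecker powers of matrices -/

section TensorPower

variable {m k : ℕ}

/-- The `k`-th Kronecker power of a matrix. -/
def tensorPower (k : ℕ) (X : Matrix (Fin m) (Fin m) ℝ) :
    Matrix (Fin k → Fin m) (Fin k → Fin m) ℝ :=
  Matrix.of fun I J => ∏ a, X (I a) (J a)

lemma sum_prod_apply (f : Fin k → Fin m → ℝ) :
    ∑ I : Fin k → Fin m, ∏ a, f a (I a) = ∏ a, ∑ i, f a i := by
  rw [Finset.prod_univ_sum, Fintype.piFinset_univ]

lemma tensorPower_mul (X Y : Matrix (Fin m) (Fin m) ℝ) :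
    tensorPower k (X * Y) = tensorPower k X * tensorPower k Y := by
  ext I J
  simp only [tensorPower, Matrix.of_apply, Matrix.mul_apply]
  rw [← sum_prod_apply (fun a i => X (I a) i * Y i (J a))]
  simp only [Finset.prod_mul_distrib]

lemma tensorPower_transpose (X : Matrix (Fin m) (Fin m) ℝ) :
    tensorPower k X.transpose = (tensorPower k X).transpose := rfl

lemma tensorPower_one : tensorPower k (1 : Matrix (Fin m) (Fin m) ℝ) = 1 := by
  ext I J
  simp only [tensorPower, Matrix.of_apply, Matrix.one_apply]
  by_cases h : I = J
  · simp [h]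
  · obtain ⟨a, ha⟩ := Function.ne_iff.1 h
    rw [if_neg h]
    exact Finset.prod_eq_zero (Finset.mem_univ a) (if_neg ha)

-- Writing `X = Rᵀ R` with `R` invertible, multiplicativity gives the power of `X` as `Tᵀ T`, where
-- `T` is the power of `R` and is again invertible.
open scoped MatrixOrder in
lemma posDef_tensorPower {X : Matrix (Fin m) (Fin m) ℝ} (hX : X.PosDef) :
    (tensorPower k X).PosDef := by
  obtain ⟨R, hR⟩ := CStarAlgebra.nonneg_iff_eq_star_mul_self.1 hX.posSemidef.nonneg
  rw [Matrix.star_eq_conjTranspose, Matrix.conjTranspose_eq_transpose_of_trivial] at hR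
  have hdet : IsUnit R.det := by
    have h := hX.det_pos
    rw [hR, Matrix.det_mul, Matrix.det_transpose] at h
    exact (left_ne_zero_of_mul h.ne').isUnit
  have hinj : Function.Injective (tensorPower k R).mulVec := by
    have h1 : tensorPower k R⁻¹ * tensorPower k R = 1 := by
      rw [← tensorPower_mul, Matrix.nonsing_inv_mul _ hdet, tensorPower_one]
    intro c d hcd
    have h2 := congrArg (fun v => (tensorPower k R⁻¹).mulVec v) hcd
    simpa [Matrix.mulVec_mulVec, h1] using h2
  have h := Matrix.PosDef.conjTranspose_mul_self _ hinj
  rwa [Matrix.conjTranspose_eq_transpose_of_trivial, ← tensorPower_transpose, ← tensorPower_mul,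
    ← hR] at h

end TensorPower

/-! ### Concatenated tuples and the sign of a block swap -/

section Tuple

variable {α β : Type*} {m k l : ℕ}

/-- The concatenation `(u₁, …, uₖ, v₁, …, vₗ)`. -/
def concat (h : k + l = m) (u : Fin k → α) (v : Fin l → α) (i : Fin m) : α :=
  Fin.append u v (Fin.cast h.symm i)

lemma comp_concat (f : α → β) (h : k + l = m) (u : Fin k → α) (v : Fin l → α) :
    f ∘ concat h u v = concat h (f ∘ u) (f ∘ v) := by
  subst h
  funext i
  refine Fin.addCases (fun a => ?_) (fun a => ?_) i <;> simp [concat]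

lemma sum_concat [Fintype α] (h : k + l = m) (f : (Fin m → α) → ℝ) :
    ∑ p, f p = ∑ u : Fin k → α, ∑ v : Fin l → α, f (concat h u v) := by
  subst h
  rw [← Fintype.sum_prod_type', ← (Fin.appendEquiv k l).sum_comp]
  rfl

lemma prod_concat (h : k + l = m) (f : α → β → ℝ) (u : Fin k → α) (v : Fin l → α)
    (u' : Fin k → β) (v' : Fin l → β) :
    ∏ i, f (concat h u v i) (concat h u' v' i) = (∏ i, f (u i) (u' i)) * ∏ i, f (v i) (v' i) := by
  subst h
  simp [Fin.prod_univ_add, concat]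

lemma finRotate_pow_val (m k : ℕ) (i : Fin m) :
    (((finRotate m) ^ k) i : ℕ) = (i + k) % m := by
  induction k with
  | zero => simp [Nat.mod_eq_of_lt i.2]
  | succ k ih =>
    obtain ⟨n, rfl⟩ : ∃ n, m = n + 1 := ⟨m - 1, by have := i.2; omega⟩
    rw [pow_succ', Equiv.Perm.mul_apply, finRotate_apply, Fin.val_add, ih, Fin.val_one',
      ← Nat.add_mod, add_assoc]

lemma concat_swap (h : k + l = m) (h' : l + k = m) (u : Fin k → α) (v : Fin l → α) :
    concat h' v u = concat h u v ∘ ⇑((finRotate m) ^ k) := by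
  funext i
  have key := finRotate_pow_val m k i
  have hi := i.2
  simp only [concat, Function.comp_apply]
  by_cases hil : (i : ℕ) < l
  · have e1 : Fin.cast h'.symm i = Fin.castAdd k ⟨i, hil⟩ := rfl
    have e2 : Fin.cast h.symm (((finRotate m) ^ k) i) = Fin.natAdd k ⟨i, hil⟩ := by
      ext
      simp only [Fin.val_cast, Fin.val_natAdd]
      rw [key, Nat.mod_eq_of_lt] <;> omega
    rw [e1, e2, Fin.append_left, Fin.append_right]
  · have e1 : Fin.cast h'.symm i = Fin.natAdd l ⟨i - l, by omega⟩ := by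
      ext
      simp only [Fin.val_cast, Fin.val_natAdd]
      omega
    have e2 : Fin.cast h.symm (((finRotate m) ^ k) i) = Fin.castAdd l ⟨i - l, by omega⟩ := by
      ext
      simp only [Fin.val_cast, Fin.val_castAdd]
      rw [key, show (i : ℕ) + k = (i - l) + m by omega, Nat.add_mod_right, Nat.mod_eq_of_lt]
      omega
    rw [e1, e2, Fin.append_left, Fin.append_right]

/-- The exponent is `(m - 1) k = k (k - 1) + k l`, and `k (k - 1)` is even. The case `k = 0` is
split off because of the truncated subtraction. -/
lemma sign_finRotate_pow (h : k + l = m) :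
    ((Equiv.Perm.sign ((finRotate m) ^ k) : ℤ) : ℝ) = (-1) ^ (k * l) := by
  rcases Nat.eq_zero_or_pos k with rfl | hk
  · simp
  rw [map_pow, sign_finRotate, ← pow_mul]
  push_cast
  have hkk : Even (k * (k - 1)) := Nat.even_mul_pred_self k
  have : (m - 1) * k = k * (k - 1) + k * l := by
    rw [mul_comm, ← mul_add]
    congr 1
    omega
  rw [this, pow_add, hkk.neg_one_pow, one_mul]

end Tuple

/-! ### Contraction of two determinants -/

section Alternating

variable {W : Type*} [AddCommGroup W] [Module ℝ W] {m k l : ℕ}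

lemma alternating_concat_swap (w : W [⋀^Fin m]→ₗ[ℝ] ℝ) (h : k + l = m) (h' : l + k = m)
    (u : Fin k → W) (v : Fin l → W) :
    w (concat h' v u) = (-1) ^ (k * l) * w (concat h u v) := by
  rw [concat_swap h h', w.map_perm, ← sign_finRotate_pow h, Units.smul_def, zsmul_eq_mul]

lemma contract_apply (h : k + l = m) (w : W [⋀^Fin m]→ₗ[ℝ] ℝ) (u : Fin k → W) (v : Fin l → W) :
    contract h w u v = w (concat h u v) := rfl

/-- The second block of `q` enumerates the complement of the range of `J`. -/
lemma exists_perm_extend (h : k + l = m) (J : Fin k → Fin m) (hJ : Function.Injective J) :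
    ∃ q : Fin k ⊕ Fin l ≃ Fin m, ∀ a, q (Sum.inl a) = J a := by
  obtain ⟨g, hg⟩ := Set.MapsTo.exists_equiv_extend_of_card_eq (α := Fin k ⊕ Fin l) (β := Fin m)
    (t := Finset.univ) (by simp [h]) (s := range Sum.inl)
    (f := Sum.elim J fun b => Fin.cast h (Fin.natAdd k b)) (by simp [Set.MapsTo])
    (by rintro _ ⟨a, rfl⟩ _ ⟨b, rfl⟩ hab; exact congrArg _ (hJ hab))
  exact ⟨g.trans (Equiv.subtypeUnivEquiv (by simp)), fun a => hg _ ⟨a, rfl⟩⟩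

lemma sign_mul_self_cast {α : Type*} [Fintype α] [DecidableEq α] (r : Equiv.Perm α) :
    ((Equiv.Perm.sign r : ℤ) : ℝ) * ((Equiv.Perm.sign r : ℤ) : ℝ) = 1 := by
  rw [← Int.cast_mul, ← Units.val_mul, Int.units_mul_self]
  simp

/-- The determinant in the basis `b`, as a function of `k + l` vectors. -/
def sumDet (h : k + l = m) (b : Module.Basis (Fin m) ℝ W) : W [⋀^Fin k ⊕ Fin l]→ₗ[ℝ] ℝ :=
  b.det.domDomCongr (finSumFinEquiv.trans (finCongr h)).symm

lemma sumDet_apply (h : k + l = m) (b : Module.Basis (Fin m) ℝ W) (f : Fin k ⊕ Fin l → W) :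
    sumDet h b f = b.det (concat h (f ∘ Sum.inl) (f ∘ Sum.inr)) := by
  subst h
  change b.det (fun i => f (finSumFinEquiv.symm i)) = _
  congr 1
  funext i
  refine Fin.addCases (fun a => ?_) (fun a => ?_) i <;> simp [concat]

lemma sumDet_comp_perm (h : k + l = m) (b : Module.Basis (Fin m) ℝ W) (f : Fin k ⊕ Fin l → W)
    (r : Equiv.Perm (Fin k ⊕ Fin l)) :
    sumDet h b (f ∘ r) = ((Equiv.Perm.sign r : ℤ) : ℝ) * sumDet h b f := by
  rw [AlternatingMap.map_perm, Units.smul_def, zsmul_eq_mul]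

lemma sumDet_basis_comp_equiv (h : k + l = m) (b : Module.Basis (Fin m) ℝ W)
    (q : Fin k ⊕ Fin l ≃ Fin m) : sumDet h b (b ∘ q) * sumDet h b (b ∘ q) = 1 := by
  change b.det (b ∘ ((finSumFinEquiv.trans (finCongr h)).symm.trans q)) *
    b.det (b ∘ ((finSumFinEquiv.trans (finCongr h)).symm.trans q)) = 1
  rw [AlternatingMap.map_perm, b.det_self, Units.smul_def, zsmul_eq_mul, mul_one]
  exact sign_mul_self_cast _

/-- The contraction `∑ σ_N ε_{JK} ε_{NK} = k! l! σ_J`. -/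
lemma sum_det_concat_mul_det_concat (h : k + l = m) (b : Module.Basis (Fin m) ℝ W)
    (σ : W [⋀^Fin k]→ₗ[ℝ] ℝ) (J : Fin k → Fin m) :
    ∑ N : Fin k → Fin m, ∑ K : Fin l → Fin m, σ (b ∘ N) *
      b.det (concat h (b ∘ J) (b ∘ K)) * b.det (concat h (b ∘ N) (b ∘ K)) =
        k.factorial * l.factorial * σ (b ∘ J) := by
  have hsum (u : Fin k → W) (v : Fin l → W) :
      b.det (concat h u v) = sumDet h b (Sum.elim u v) := by
    rw [sumDet_apply, Sum.elim_comp_inl, Sum.elim_comp_inr]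
  by_cases hJ : Function.Injective J
  swap
  · have h0 : σ (b ∘ J) = 0 :=
      σ.map_eq_zero_of_not_injective _ fun hi => hJ (Function.Injective.of_comp hi)
    have h1 (K : Fin l → Fin m) : b.det (concat h (b ∘ J) (b ∘ K)) = 0 := by
      rw [hsum]
      refine AlternatingMap.map_eq_zero_of_not_injective _ _ fun hi => hJ ?_
      have h2 := hi.comp Sum.inl_injective
      rw [Sum.elim_comp_inl] at h2
      exact Function.Injective.of_comp h2
    simp [h0, h1]
  obtain ⟨q, hq⟩ := exists_perm_extend h J hJ
  let F : (Fin k ⊕ Fin l → Fin m) → ℝ := fun f => σ (b ∘ f ∘ Sum.inl) *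
    sumDet h b (Sum.elim (b ∘ J) (b ∘ f ∘ Sum.inr)) * sumDet h b (b ∘ f)
  have e1 : ∑ N : Fin k → Fin m, ∑ K : Fin l → Fin m, σ (b ∘ N) *
      b.det (concat h (b ∘ J) (b ∘ K)) * b.det (concat h (b ∘ N) (b ∘ K)) = ∑ f, F f := by
    rw [← Fintype.sum_prod_type', ← (Equiv.sumArrowEquivProdArrow _ _ _).sum_comp]
    refine Finset.sum_congr rfl fun f _ => ?_
    simp only [F, hsum]
    congr 2
    funext i
    cases i <;> rfl
  have hqJ : q ∘ Sum.inl = J := funext hq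
  -- Only the tuples `q ∘ (μ ⊕ ρ)` with permutations `μ`, `ρ` of the two blocks contribute. There
  -- are `k! l!` of them, each contributing `σ (b ∘ J)`.
  rw [e1, ← Fintype.sum_of_injective
    (fun p : Equiv.Perm (Fin k) × Equiv.Perm (Fin l) => q ∘ (Equiv.sumCongr p.1 p.2)) ?_
    (fun _ => σ (b ∘ J)) F ?_ ?_]
  · simp [Fintype.card_perm, mul_assoc]
  · intro p p' hp
    refine Equiv.Perm.sumCongrHom_injective (a₁ := p) (a₂ := p') ?_
    ext1 x
    exact q.injective (congrFun hp x)
  · intro f hf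
    by_cases hfi : Function.Injective f
    swap
    · have : sumDet h b (b ∘ f) = 0 :=
        AlternatingMap.map_eq_zero_of_not_injective _ _ fun hi => hfi (Function.Injective.of_comp hi)
      simp [F, this]
    · have hbij : Function.Bijective f :=
        (Fintype.bijective_iff_injective_and_card f).2 ⟨hfi, by simp [h]⟩
      let r : Equiv.Perm (Fin k ⊕ Fin l) := (Equiv.ofBijective f hbij).trans q.symm
      -- Otherwise `r = q⁻¹ ∘ f` mixes the blocks, so some `J a` is also a value of the second block
      -- of `f`, and the determinant of `J` with that block has a repeated argument.
      have hr : r ∉ (Equiv.Perm.sumCongrHom (Fin k) (Fin l)).range := by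
        rintro ⟨p, hp⟩
        refine hf ⟨p, ?_⟩
        funext x
        have := Equiv.congr_fun hp x
        simpa [r] using congrArg q this
      have hr' : r⁻¹ ∉ (Equiv.Perm.sumCongrHom (Fin k) (Fin l)).range := fun h' =>
        hr (by simpa using inv_mem h')
      have : ∃ a d, r⁻¹ (Sum.inl a) = Sum.inr d := by
        by_contra! hc
        refine hr' (Equiv.Perm.mem_sumCongrHom_range_of_perm_mapsTo_inl ?_)
        rintro _ ⟨a, rfl⟩
        cases hx : r⁻¹ (Sum.inl a) with
        | inl y => exact ⟨y, rfl⟩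
        | inr y => exact absurd hx (hc a y)
      obtain ⟨a, d, had⟩ := this
      have hJf : J a = f (Sum.inr d) := by
        rw [Equiv.Perm.inv_eq_iff_eq] at had
        rw [← hq, had]
        simp [r]
      have : sumDet h b (Sum.elim (b ∘ J) (b ∘ f ∘ Sum.inr)) = 0 :=
        AlternatingMap.map_eq_zero_of_eq _ _ (i := Sum.inl a) (j := Sum.inr d) (by simp [hJf])
          (by simp)
      simp [F, this]
  · rintro ⟨μ, ρ⟩
    have h1 : σ (b ∘ (q ∘ Equiv.sumCongr μ ρ) ∘ Sum.inl) =
        ((Equiv.Perm.sign μ : ℤ) : ℝ) * σ (b ∘ J) := by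
      have : b ∘ (q ∘ Equiv.sumCongr μ ρ) ∘ Sum.inl = (b ∘ J) ∘ μ := by
        rw [← hqJ]; rfl
      rw [this, σ.map_perm, Units.smul_def, zsmul_eq_mul]
    have h2 : sumDet h b (Sum.elim (b ∘ J) (b ∘ (q ∘ Equiv.sumCongr μ ρ) ∘ Sum.inr)) =
        ((Equiv.Perm.sign ρ : ℤ) : ℝ) * sumDet h b (b ∘ q) := by
      have : Sum.elim (b ∘ J) (b ∘ (q ∘ Equiv.sumCongr μ ρ) ∘ Sum.inr) =
          (b ∘ q) ∘ (Equiv.Perm.sumCongr 1 ρ) := by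
        rw [← hqJ]
        funext x
        cases x <;> rfl
      rw [this, sumDet_comp_perm, Equiv.Perm.sign_sumCongr]
      simp
    have h3 : sumDet h b (b ∘ q ∘ Equiv.sumCongr μ ρ) =
        ((Equiv.Perm.sign μ : ℤ) : ℝ) * ((Equiv.Perm.sign ρ : ℤ) : ℝ) *
          sumDet h b (b ∘ q) := by
      have := sumDet_comp_perm h b (b ∘ q) (Equiv.Perm.sumCongr μ ρ)
      rw [Equiv.Perm.sign_sumCongr] at this
      simpa [Function.comp_assoc] using this
    -- The sign of `μ`, the sign of `ρ` and the determinant of `b ∘ q` each occur exactly twice.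
    have s1 := sign_mul_self_cast μ
    have s2 := sign_mul_self_cast ρ
    simp only [F]
    rw [h1, h2, h3]
    have s3 := sumDet_basis_comp_equiv h b q
    generalize sumDet h b (b ∘ q) = x at *
    generalize ((Equiv.Perm.sign μ : ℤ) : ℝ) = y at *
    generalize ((Equiv.Perm.sign ρ : ℤ) : ℝ) = z at *
    linear_combination (-(σ (b ∘ J)) * (z * z * x * x)) * s1 -
      σ (b ∘ J) * x * x * s2 - σ (b ∘ J) * s3

end Alternating

/-! ### Independence of the basis, and naturality -/

section BasisChange

variable {W W' : Type*} [AddCommGroup W] [Module ℝ W] [AddCommGroup W'] [Module ℝ W'] {m k l : ℕ}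

lemma gram_basis_change (b b' : Module.Basis (Fin m) ℝ W) (B : W →ₗ[ℝ] W →ₗ[ℝ] ℝ) :
    gram b' (fun v w => B v w) =
      (b.toMatrix b').transpose * gram b (fun v w => B v w) * b.toMatrix b' := by
  ext i j
  simp only [gram, Matrix.of_apply, Matrix.mul_apply, Matrix.transpose_apply]
  conv_lhs => rw [← b.sum_toMatrix_smul_self b' i, ← b.sum_toMatrix_smul_self b' j]
  simp only [map_sum, LinearMap.sum_apply, map_smul, LinearMap.smul_apply, smul_eq_mul,
    Finset.sum_mul, Finset.mul_sum]
  refine Finset.sum_congr rfl fun a _ => Finset.sum_congr rfl fun c _ => by ring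

lemma multilinear_basis_change (b b' : Module.Basis (Fin m) ℝ W)
    (p : MultilinearMap ℝ (fun _ : Fin k => W) ℝ) :
    (fun J : Fin k → Fin m => p (b' ∘ J)) =
      (tensorPower k (b.toMatrix b')).transpose.mulVec (fun I => p (b ∘ I)) := by
  classical
  funext J
  have : b' ∘ J = fun a => ∑ i, b.toMatrix b' i (J a) • b i := by
    funext a
    exact (b.sum_toMatrix_smul_self b' (J a)).symm
  rw [this, p.map_sum]
  simp only [p.map_smul_univ, Matrix.mulVec, dotProduct, Matrix.transpose_apply, tensorPower,
    Matrix.of_apply, smul_eq_mul]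
  rfl

lemma sum_dualGram_eq_dotProduct (b : Module.Basis (Fin m) ℝ W) (B : W → W → ℝ)
    (p q : (Fin k → W) → ℝ) :
    ∑ I : Fin k → Fin m, ∑ J : Fin k → Fin m, dualGram b B I J * p (b ∘ I) * q (b ∘ J) =
      (fun I => p (b ∘ I)) ⬝ᵥ (tensorPower k (gram b B)⁻¹).mulVec (fun J => q (b ∘ J)) := by
  simp only [dotProduct, Matrix.mulVec, Finset.mul_sum]
  refine Finset.sum_congr rfl fun I _ => Finset.sum_congr rfl fun J _ => ?_
  change _ = p (b ∘ I) * (dualGram b B I J * q (b ∘ J))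
  ring

/-- With `P` the transition matrix, components change by the Kronecker power of `Pᵀ`, while `(Pᵀ G
P)⁻¹ = P⁻¹ G⁻¹ (Pᵀ)⁻¹`. By multiplicativity of `tensorPower` all factors cancel. -/
lemma sum_dualGram_basis_change (b b' : Module.Basis (Fin m) ℝ W) (B : W →ₗ[ℝ] W →ₗ[ℝ] ℝ)
    (p q : MultilinearMap ℝ (fun _ : Fin k => W) ℝ) :
    ∑ I : Fin k → Fin m, ∑ J : Fin k → Fin m,
        dualGram b' (fun v w => B v w) I J * p (b' ∘ I) * q (b' ∘ J) =
      ∑ I : Fin k → Fin m, ∑ J : Fin k → Fin m,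
        dualGram b (fun v w => B v w) I J * p (b ∘ I) * q (b ∘ J) := by
  classical
  rw [sum_dualGram_eq_dotProduct b' _ p q, sum_dualGram_eq_dotProduct b _ p q,
    multilinear_basis_change b b' p, multilinear_basis_change b b' q, gram_basis_change b b' B]
  set P := b.toMatrix b'
  set G := gram b fun v w => B v w
  have hP : P * P⁻¹ = 1 := Matrix.mul_nonsing_inv _ (by
    have := b.invertibleToMatrix b'
    exact Matrix.isUnit_det_of_invertible P)
  have hP' : P⁻¹.transpose * P.transpose = 1 := by
    rw [← Matrix.transpose_mul, hP, Matrix.transpose_one]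
  have key : tensorPower k P * (tensorPower k (P.transpose * G * P)⁻¹ *
      tensorPower k P.transpose) = tensorPower k G⁻¹ := by
    rw [← tensorPower_mul, ← tensorPower_mul, Matrix.mul_inv_rev, Matrix.mul_inv_rev,
      ← Matrix.transpose_nonsing_inv]
    congr 1
    rw [← Matrix.mul_assoc, ← Matrix.mul_assoc, hP, Matrix.one_mul, Matrix.mul_assoc, hP',
      Matrix.mul_one]
  rw [← key, tensorPower_transpose, ← Matrix.mulVec_mulVec, ← Matrix.mulVec_mulVec,
    Matrix.mulVec_transpose, Matrix.dotProduct_mulVec (fun I => p (b ∘ I))]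

lemma formInner_basis_change (b b' : Module.Basis (Fin m) ℝ W) (B : W →ₗ[ℝ] W →ₗ[ℝ] ℝ)
    (α β : W [⋀^Fin k]→ₗ[ℝ] ℝ) :
    formInner b' (fun v w => B v w) α β = formInner b (fun v w => B v w) α β := by
  have h := sum_dualGram_basis_change b b' B α.toMultilinearMap β.toMultilinearMap
  simp only [AlternatingMap.coe_multilinearMap] at h
  rw [formInner, h, formInner]

lemma basis_map_comp (b : Module.Basis (Fin m) ℝ W) (e : W ≃ₗ[ℝ] W') (J : Fin k → Fin m) :
    ⇑(b.map e) ∘ J = e ∘ b ∘ J := by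
  funext i; simp

lemma dualGram_map (b : Module.Basis (Fin m) ℝ W) (e : W ≃ₗ[ℝ] W') (B : W' → W' → ℝ)
    (I J : Fin k → Fin m) :
    dualGram (b.map e) B I J = dualGram b (fun v w => B (e v) (e w)) I J := by
  simp [dualGram, gram]

/-- The inner product of forms is natural under linear isomorphisms. -/
lemma formInner_comp (b : Module.Basis (Fin m) ℝ W) (b' : Module.Basis (Fin m) ℝ W')
    (e : W ≃ₗ[ℝ] W') (B : W' →ₗ[ℝ] W' →ₗ[ℝ] ℝ) (α β : W' [⋀^Fin k]→ₗ[ℝ] ℝ) :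
    formInner b' (fun v w => B v w) α β = formInner b (fun v w => B (e v) (e w))
      (α.compLinearMap e.toLinearMap) (β.compLinearMap e.toLinearMap) := by
  rw [formInner_basis_change (b.map e) b' B]
  simp only [formInner, dualGram_map, basis_map_comp]
  rfl

lemma posOriented_iff_det (b : Module.Basis (Fin m) ℝ W) (o : Orientation ℝ W (Fin m))
    (v : Fin m → W) :
    PosOriented o v ↔ 0 < b.det v * Module.Ray.someVector o b := by
  conv_lhs => rw [PosOriented, AlternatingMap.eq_smul_basis_det b (Module.Ray.someVector o)]
  rw [AlternatingMap.smul_apply, smul_eq_mul, mul_comm]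

lemma someVector_basis_ne_zero (b : Module.Basis (Fin m) ℝ W) (o : Orientation ℝ W (Fin m)) :
    Module.Ray.someVector o b ≠ 0 :=
  (AlternatingMap.map_basis_ne_zero_iff b _).2 (Module.Ray.someVector_ne_zero o)

/-- The Gram determinant acquires `(det b')²`, hence its root acquires `|det b'|`. The change of the
orientation sign from `b` to `b'` is the sign of `det b'`, which removes the absolute value. -/
lemma volForm_basis_change (b b' : Module.Basis (Fin m) ℝ W) (B : W →ₗ[ℝ] W →ₗ[ℝ] ℝ)
    (o : Orientation ℝ W (Fin m)) :
    volForm b' (fun v w => B v w) o = volForm b (fun v w => B v w) o := by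
  classical
  have hdet : b.det b' ≠ 0 := (b.isUnit_det b').ne_zero
  have h0 := someVector_basis_ne_zero b o
  rw [volForm, volForm, AlternatingMap.eq_smul_basis_det b' b.det, smul_smul,
    gram_basis_change b b' B, Matrix.det_mul, Matrix.det_mul, Matrix.det_transpose,
    ← Module.Basis.det_apply]
  congr 1
  rw [show b.det b' * (gram b fun v w => B v w).det * b.det b' =
    b.det b' ^ 2 * (gram b fun v w => B v w).det by ring, Real.sqrt_mul (sq_nonneg _),
    Real.sqrt_sq_eq_abs]
  have h1 := posOriented_iff_det b o b'
  have h2 := posOriented_iff_det b o b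
  rw [b.det_self, one_mul] at h2
  rcases lt_or_gt_of_ne hdet with hd | hd <;> rcases lt_or_gt_of_ne h0 with hs | hs
  · rw [if_pos (h1.2 (mul_pos_of_neg_of_neg hd hs)), if_neg (fun h => (h2.1 h).not_gt hs),
      abs_of_neg hd]
    ring
  · rw [if_neg (fun h => (h1.1 h).not_gt (mul_neg_of_neg_of_pos hd hs)), if_pos (h2.2 hs),
      abs_of_neg hd]
    ring
  · rw [if_neg (fun h => (h1.1 h).not_gt (mul_neg_of_pos_of_neg hd hs)),
      if_neg (fun h => (h2.1 h).not_gt hs), abs_of_pos hd]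
    ring
  · rw [if_pos (h1.2 (mul_pos hd hs)), if_pos (h2.2 hs), abs_of_pos hd]
    ring

lemma alternating_sum_apply {ι : Type*} (s : Finset ι) (f : ι → W [⋀^Fin k]→ₗ[ℝ] ℝ)
    (v : Fin k → W) : (∑ i ∈ s, f i) v = ∑ i ∈ s, f i v :=
  map_sum ({ toFun := fun w => w v, map_zero' := rfl, map_add' := fun _ _ => rfl } :
    (W [⋀^Fin k]→ₗ[ℝ] ℝ) →+ ℝ) f s

lemma hodgeStar_apply (b : Module.Basis (Fin m) ℝ W) (B : W → W → ℝ)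
    (o : Orientation ℝ W (Fin m)) (h : k + l = m) (β : W [⋀^Fin k]→ₗ[ℝ] ℝ) (v : Fin l → W) :
    hodgeStar b B o h β v = ((k.factorial : ℝ))⁻¹ * ∑ I : Fin k → Fin m, ∑ J : Fin k → Fin m,
      dualGram b B I J * β (b ∘ I) * volForm b B o (concat h (b ∘ J) v) := by
  simp only [hodgeStar, AlternatingMap.smul_apply, alternating_sum_apply, smul_eq_mul,
    contract_apply]

lemma hodgeStar_basis_change (b b' : Module.Basis (Fin m) ℝ W) (B : W →ₗ[ℝ] W →ₗ[ℝ] ℝ)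
    (o : Orientation ℝ W (Fin m)) (h : k + l = m) (β : W [⋀^Fin k]→ₗ[ℝ] ℝ) :
    hodgeStar b' (fun v w => B v w) o h β = hodgeStar b (fun v w => B v w) o h β := by
  ext v
  rw [hodgeStar_apply, hodgeStar_apply, volForm_basis_change b b' B o]
  -- `contract` fixes the leading arguments, but here the trailing `v` is fixed. Swapping the
  -- blocks, at the cost of a sign, makes the volume form a multilinear map of the summed arguments.
  have h' : l + k = m := by omega
  have hs := sum_dualGram_basis_change b b' B β.toMultilinearMap
    ((-1 : ℝ) ^ (l * k) • contract h' (volForm b (fun v w => B v w) o) v).toMultilinearMap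
  simp only [AlternatingMap.coe_multilinearMap, AlternatingMap.smul_apply, contract_apply,
    smul_eq_mul] at hs
  simp only [← alternating_concat_swap _ h' h] at hs
  rw [hs]

/-- The Hodge star is natural under orientation preserving linear isomorphisms. -/
lemma hodgeStar_comp (b : Module.Basis (Fin m) ℝ W) (b' : Module.Basis (Fin m) ℝ W')
    (e : W ≃ₗ[ℝ] W') (B : W' →ₗ[ℝ] W' →ₗ[ℝ] ℝ) (o : Orientation ℝ W (Fin m))
    (o' : Orientation ℝ W' (Fin m)) (ho : PosOriented o b ↔ PosOriented o' (fun i => e (b i)))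
    (h : k + l = m) (β : W' [⋀^Fin k]→ₗ[ℝ] ℝ) :
    (hodgeStar b' (fun v w => B v w) o' h β).compLinearMap e.toLinearMap =
      hodgeStar b (fun v w => B (e v) (e w)) o h (β.compLinearMap e.toLinearMap) := by
  classical
  ext v
  have ho' : PosOriented o' (b.map e) ↔ PosOriented o b := by
    rw [ho]
    have : ⇑(b.map e) = fun i => e (b i) := by funext i; simp
    rw [this]
  have hvol (u : Fin m → W) : volForm (b.map e) (fun v w => B v w) o' (e ∘ u) =
      volForm b (fun v w => B (e v) (e w)) o u := by
    have hg : gram (b.map e) (fun v w => B v w) = gram b (fun v w => B (e v) (e w)) := by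
      ext i j
      simp [gram]
    have hd : (b.map e).det (e ∘ u) = b.det u := by
      rw [Module.Basis.det_map]
      congr 1
      funext i
      simp
    simp only [volForm, AlternatingMap.smul_apply, hg, hd, ho']
  rw [hodgeStar_basis_change (b.map e) b' B, AlternatingMap.compLinearMap_apply, hodgeStar_apply,
    hodgeStar_apply]
  simp only [dualGram_map, basis_map_comp]
  congr 1
  refine Finset.sum_congr rfl fun I _ => Finset.sum_congr rfl fun J _ => ?_
  congr 1
  rw [← hvol, comp_concat]
  rfl

end BasisChange

/-! ### The Hodge star and the wedge pairing -/

section Pairing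

variable {W : Type*} [AddCommGroup W] [Module ℝ W] {m k l : ℕ}

lemma posDef_gram (b : Module.Basis (Fin m) ℝ W) (B : W →ₗ[ℝ] W →ₗ[ℝ] ℝ)
    (hs : ∀ v w, B v w = B w v) (hp : ∀ v, v ≠ 0 → 0 < B v v) :
    (gram b (fun v w => B v w)).PosDef := by
  refine Matrix.PosDef.of_dotProduct_mulVec_pos ?_ fun c hc => ?_
  · ext i j
    simp [gram, hs (b j)]
  · have h := hp (∑ i, c i • b i) fun h => hc <| by
      funext i
      exact (Fintype.linearIndependent_iff.1 b.linearIndependent) c h i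
    refine h.trans_eq ?_
    symm
    simp only [dotProduct, Matrix.mulVec, gram, Matrix.of_apply, map_sum, LinearMap.sum_apply,
      map_smul, LinearMap.smul_apply, smul_eq_mul, Finset.mul_sum, Pi.star_apply, star_trivial]
    rw [Finset.sum_comm]
    refine Finset.sum_congr rfl fun i _ => Finset.sum_congr rfl fun j _ => by ring

lemma dualGram_symm (b : Module.Basis (Fin m) ℝ W) (B : W → W → ℝ) (hs : (gram b B).PosDef)
    (I J : Fin k → Fin m) : dualGram b B I J = dualGram b B J I := by
  refine Finset.prod_congr rfl fun a _ => ?_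
  have h := hs.inv.isHermitian
  rw [Matrix.IsHermitian, Matrix.conjTranspose_eq_transpose_of_trivial] at h
  exact congrFun (congrFun h (J a)) (I a)

/-- Raising all indices of the determinant. -/
lemma sum_prod_mul_det (b : Module.Basis (Fin m) ℝ W) (X : Matrix (Fin m) (Fin m) ℝ)
    (P : Fin m → Fin m) :
    ∑ Q : Fin m → Fin m, (∏ i, X (P i) (Q i)) * b.det (b ∘ Q) = X.det * b.det (b ∘ P) := by
  have h : (Matrix.toLin b b X.transpose) ∘ (b ∘ P) = fun i => ∑ q, X (P i) q • b q := by
    funext i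
    simp [Matrix.toLin_self]
  rw [← Matrix.det_transpose, ← LinearMap.det_toLin b, ← Module.Basis.det_comp, h]
  have h2 := (b.det.toMultilinearMap).map_sum fun i q => X (P i) q • b q
  rw [AlternatingMap.coe_multilinearMap] at h2
  rw [h2]
  refine Finset.sum_congr rfl fun Q _ => ?_
  have h3 := (b.det.toMultilinearMap).map_smul_univ (fun i => X (P i) (Q i)) (b ∘ Q)
  exact h3.symm

lemma sum_dualGram_mul_det (b : Module.Basis (Fin m) ℝ W) (B : W → W → ℝ) (h : l + k = m)
    (K : Fin l → Fin m) (N : Fin k → Fin m) :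
    ∑ K' : Fin l → Fin m, ∑ L : Fin k → Fin m,
      dualGram b B K K' * dualGram b B N L * b.det (concat h (b ∘ K') (b ∘ L)) =
        (gram b B).det⁻¹ * b.det (concat h (b ∘ K) (b ∘ N)) := by
  have h1 := sum_prod_mul_det b (gram b B)⁻¹ (concat h K N)
  rw [sum_concat h] at h1
  simp only [prod_concat h (fun i j => (gram b B)⁻¹ i j), comp_concat] at h1
  rw [Matrix.det_nonsing_inv, Ring.inverse_eq_inv'] at h1
  exact h1

/-- The sign of the basis `b`. -/
def orientationSign (b : Module.Basis (Fin m) ℝ W) (o : Orientation ℝ W (Fin m)) : ℝ :=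
  open scoped Classical in if PosOriented o b then 1 else -1

lemma volForm_apply (b : Module.Basis (Fin m) ℝ W) (B : W → W → ℝ) (o : Orientation ℝ W (Fin m))
    (v : Fin m → W) :
    volForm b B o v = orientationSign b o * Real.sqrt (gram b B).det * b.det v := rfl

lemma orientationSign_mul_self (b : Module.Basis (Fin m) ℝ W) (o : Orientation ℝ W (Fin m)) :
    orientationSign b o * orientationSign b o = 1 := by
  unfold orientationSign
  split_ifs <;> norm_num

/-- The volume density times `⟪⋆γ, σ⟫` does not depend on the metric. -/
lemma formInner_hodgeStar_mul_sqrt (b : Module.Basis (Fin m) ℝ W) (B : W → W → ℝ)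
    (hB : (gram b B).PosDef) (o : Orientation ℝ W (Fin m)) (h : l + k = m)
    (γ : W [⋀^Fin l]→ₗ[ℝ] ℝ) (σ : W [⋀^Fin k]→ₗ[ℝ] ℝ) :
    formInner b B (hodgeStar b B o h γ) σ * Real.sqrt (gram b B).det =
      orientationSign b o * ((k.factorial : ℝ)⁻¹ * (l.factorial : ℝ)⁻¹ *
        ∑ K : Fin l → Fin m, ∑ N : Fin k → Fin m,
          γ (b ∘ K) * σ (b ∘ N) * b.det (concat h (b ∘ K) (b ∘ N))) := by
  have hd : 0 < (gram b B).det := hB.det_pos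
  have e1 : ∑ L : Fin k → Fin m, ∑ N : Fin k → Fin m,
      dualGram b B L N * hodgeStar b B o h γ (b ∘ L) * σ (b ∘ N) =
      (l.factorial : ℝ)⁻¹ * (orientationSign b o * Real.sqrt (gram b B).det *
        ∑ K : Fin l → Fin m, ∑ N : Fin k → Fin m, γ (b ∘ K) * σ (b ∘ N) *
          ∑ K' : Fin l → Fin m, ∑ L : Fin k → Fin m,
            dualGram b B K K' * dualGram b B N L * b.det (concat h (b ∘ K') (b ∘ L))) := by
    simp only [hodgeStar_apply, volForm_apply, Finset.mul_sum, Finset.sum_mul]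
    rw [Finset.sum_comm]
    rw [Finset.sum_comm (s := (Finset.univ : Finset (Fin l → Fin m)))
      (t := (Finset.univ : Finset (Fin k → Fin m)))]
    refine Finset.sum_congr rfl fun N _ => ?_
    rw [Finset.sum_comm]
    refine Finset.sum_congr rfl fun K _ => ?_
    rw [Finset.sum_comm]
    refine Finset.sum_congr rfl fun K' _ => Finset.sum_congr rfl fun L _ => ?_
    rw [dualGram_symm b B hB L N]
    ring
  -- One root comes from the volume form inside the star, the other from the density. Their product
  -- cancels the `det⁻¹` produced by raising all indices, so the metric disappears.
  have hsq := Real.mul_self_sqrt hd.le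
  rw [formInner, e1]
  simp only [sum_dualGram_mul_det]
  have e2 : ∑ K : Fin l → Fin m, ∑ N : Fin k → Fin m, γ (b ∘ K) * σ (b ∘ N) *
      ((gram b B).det⁻¹ * b.det (concat h (b ∘ K) (b ∘ N))) = (gram b B).det⁻¹ *
      ∑ K : Fin l → Fin m, ∑ N : Fin k → Fin m, γ (b ∘ K) * σ (b ∘ N) *
        b.det (concat h (b ∘ K) (b ∘ N)) := by
    simp only [Finset.mul_sum]
    refine Finset.sum_congr rfl fun K _ => Finset.sum_congr rfl fun L _ => by ring
  rw [e2]
  have hinv : (gram b B).det * (gram b B).det⁻¹ = 1 := mul_inv_cancel₀ hd.ne'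
  generalize (∑ K : Fin l → Fin m, ∑ N : Fin k → Fin m, γ (b ∘ K) * σ (b ∘ N) *
        b.det (concat h (b ∘ K) (b ∘ N))) = S
  generalize Real.sqrt (gram b B).det = r at *
  linear_combination (orientationSign b o * (k.factorial : ℝ)⁻¹ * (l.factorial : ℝ)⁻¹ * S *
    (gram b B).det⁻¹) * hsq + (orientationSign b o * (k.factorial : ℝ)⁻¹ * (l.factorial : ℝ)⁻¹ *
      S) * hinv

/-- The wedge product of `⋆β` and `σ`. -/
lemma sum_hodgeStar_mul_det (b : Module.Basis (Fin m) ℝ W) (B : W → W → ℝ)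
    (o : Orientation ℝ W (Fin m)) (h : k + l = m) (h' : l + k = m)
    (β σ : W [⋀^Fin k]→ₗ[ℝ] ℝ) :
    (k.factorial : ℝ)⁻¹ * (l.factorial : ℝ)⁻¹ *
        ∑ K : Fin l → Fin m, ∑ N : Fin k → Fin m,
          hodgeStar b B o h β (b ∘ K) * σ (b ∘ N) * b.det (concat h' (b ∘ K) (b ∘ N)) =
      (-1) ^ (k * l) * (orientationSign b o * Real.sqrt (gram b B).det * formInner b B β σ) := by
  have hk : (k.factorial : ℝ) ≠ 0 := by positivity
  have hl : (l.factorial : ℝ) ≠ 0 := by positivity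
  -- Moving the block `K` behind `N` costs `(-1)^(kl)`. The sum over `N` and `K` is then the
  -- contraction of two determinants, whose `k! l!` cancels the normalisation.
  have e1 : ∑ K : Fin l → Fin m, ∑ N : Fin k → Fin m,
        hodgeStar b B o h β (b ∘ K) * σ (b ∘ N) * b.det (concat h' (b ∘ K) (b ∘ N)) =
      (k.factorial : ℝ)⁻¹ * ((-1) ^ (k * l) * (orientationSign b o * Real.sqrt (gram b B).det *
        ∑ I : Fin k → Fin m, ∑ J : Fin k → Fin m, dualGram b B I J * β (b ∘ I) *
          ∑ N : Fin k → Fin m, ∑ K : Fin l → Fin m, σ (b ∘ N) *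
            b.det (concat h (b ∘ J) (b ∘ K)) * b.det (concat h (b ∘ N) (b ∘ K)))) := by
    simp only [hodgeStar_apply, volForm_apply, Finset.mul_sum, Finset.sum_mul,
      alternating_concat_swap b.det h h']
    rw [Finset.sum_comm, Finset.sum_congr rfl fun N _ => Finset.sum_comm, Finset.sum_comm]
    refine Finset.sum_congr rfl fun I _ => ?_
    rw [Finset.sum_congr rfl fun N _ => Finset.sum_comm, Finset.sum_comm]
    refine Finset.sum_congr rfl fun J _ => Finset.sum_congr rfl fun N _ =>
      Finset.sum_congr rfl fun K _ => ?_
    ring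
  simp only [sum_det_concat_mul_det_concat] at e1
  rw [e1, formInner]
  have e2 : ∑ I : Fin k → Fin m, ∑ J : Fin k → Fin m, dualGram b B I J * β (b ∘ I) *
      (k.factorial * l.factorial * σ (b ∘ J)) = k.factorial * l.factorial *
      ∑ I : Fin k → Fin m, ∑ J : Fin k → Fin m, dualGram b B I J * β (b ∘ I) * σ (b ∘ J) := by
    simp only [Finset.mul_sum]
    refine Finset.sum_congr rfl fun I _ => Finset.sum_congr rfl fun J _ => by ring
  rw [e2]
  field_simp

lemma formInner_smul_left (b : Module.Basis (Fin m) ℝ W) (B : W → W → ℝ) (c : ℝ)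
    (α β : W [⋀^Fin k]→ₗ[ℝ] ℝ) : formInner b B (c • α) β = c * formInner b B α β := by
  simp only [formInner, AlternatingMap.smul_apply, smul_eq_mul, Finset.mul_sum]
  refine Finset.sum_congr rfl fun I _ => Finset.sum_congr rfl fun J _ => by ring

/-- For two metrics `B`, `B'` on the same oriented space, `(-1) ^ (k l) ⋆ ⋆'` intertwines the inner
products of `k`-forms weighted with the volume densities. -/
lemma formInner_hodgeStar_hodgeStar (b : Module.Basis (Fin m) ℝ W) (B B' : W → W → ℝ)
    (hB : (gram b B).PosDef) (o : Orientation ℝ W (Fin m)) (h : k + l = m) (h' : l + k = m)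
    (β σ : W [⋀^Fin k]→ₗ[ℝ] ℝ) :
    formInner b B ((-1 : ℝ) ^ (k * l) • hodgeStar b B o h' (hodgeStar b B' o h β)) σ *
        Real.sqrt (gram b B).det =
      formInner b B' β σ * Real.sqrt (gram b B').det := by
  have hs : ((-1 : ℝ) ^ (k * l)) * (-1) ^ (k * l) = 1 := by
    rw [← mul_pow]; norm_num
  -- The left side becomes the metric-free pairing of `⋆'β` with `σ`, which is then evaluated
  -- through `B'`. The two orientation signs and the two powers of `-1` square to one.
  rw [formInner_smul_left, mul_assoc, formInner_hodgeStar_mul_sqrt b B hB,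
    sum_hodgeStar_mul_det b B' o h h']
  linear_combination (orientationSign b o * orientationSign b o * (formInner b B' β σ *
    Real.sqrt (gram b B').det)) * hs + (formInner b B' β σ * Real.sqrt (gram b B').det) *
      orientationSign_mul_self b o

end Pairing

/-! ### Geometry of the standard simplex -/

section Simplex

variable {m : ℕ}

lemma convex_simplex (m : ℕ) : Convex ℝ (simplex m) := by
  rintro x ⟨hx, hx'⟩ y ⟨hy, hy'⟩ a b ha hb hab
  refine ⟨fun i => ?_, ?_⟩
  · simpa using add_nonneg (mul_nonneg ha (hx i)) (mul_nonneg hb (hy i))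
  · have : ∑ i, (a • x + b • y) i = a * ∑ i, x i + b * ∑ i, y i := by
      simp [Finset.sum_add_distrib, Finset.mul_sum]
    rw [this]
    nlinarith

lemma isClosed_simplex (m : ℕ) : IsClosed (simplex m) := by
  have h : simplex m = (⋂ i, {t : Coord m | 0 ≤ t i}) ∩ {t | ∑ i, t i ≤ 1} := by
    ext t
    simp [simplex]
  rw [h]
  exact (isClosed_iInter fun i => isClosed_le (by fun_prop) (by fun_prop)).inter
    (isClosed_le (by fun_prop) (by fun_prop))

lemma measurableSet_simplex (m : ℕ) : MeasurableSet (simplex m) :=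
  (isClosed_simplex m).measurableSet

lemma isCompact_simplex (m : ℕ) : IsCompact (simplex m) := by
  refine Metric.isCompact_of_isClosed_isBounded (isClosed_simplex m) ?_
  refine (Metric.isBounded_closedBall (x := (0 : Coord m)) (r := Real.sqrt m)).subset ?_
  rintro t ⟨h0, h1⟩
  rw [mem_closedBall_zero_iff, EuclideanSpace.norm_eq]
  refine Real.sqrt_le_sqrt ?_
  have h (i : Fin m) : ‖t i‖ ^ 2 ≤ 1 := by
    have h2 : t i ≤ 1 := (Finset.single_le_sum (fun j _ => h0 j) (Finset.mem_univ i)).trans h1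
    rw [Real.norm_eq_abs, sq_abs]
    nlinarith [h0 i]
  calc ∑ i, ‖t i‖ ^ 2 ≤ ∑ _i : Fin m, (1 : ℝ) := Finset.sum_le_sum fun i _ => h i
    _ = m := by simp

lemma pos_of_mem_interior_simplex {t : Coord m} (ht : t ∈ interior (simplex m)) (i : Fin m) :
    0 < t i := by
  have hsurj : Function.Surjective (EuclideanSpace.proj i : Coord m →L[ℝ] ℝ) := fun r =>
    ⟨EuclideanSpace.single i r, by simp⟩
  have hsub : simplex m ⊆ (EuclideanSpace.proj i : Coord m →L[ℝ] ℝ) ⁻¹' Ici 0 := fun t ht => ht.1 i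
  have h := interior_mono hsub ht
  rw [ContinuousLinearMap.interior_preimage _ hsurj, interior_Ici] at h
  exact h

lemma sum_lt_one_of_mem_interior_simplex {t : Coord m} (ht : t ∈ interior (simplex m)) :
    ∑ i, t i < 1 := by
  -- For `m = 0` the functional `f` below would be zero, hence not surjective.
  rcases isEmpty_or_nonempty (Fin m) with hm | ⟨⟨i₀⟩⟩
  · simp
  let f : Coord m →L[ℝ] ℝ := ∑ i, EuclideanSpace.proj i
  have hf (t : Coord m) : f t = ∑ i, t i := by simp [f]
  have hsurj : Function.Surjective f := fun r =>
    ⟨EuclideanSpace.single i₀ r, by simp [hf]⟩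
  have hsub : simplex m ⊆ f ⁻¹' Iic 1 := fun t ht => by simpa [hf] using ht.2
  have h := interior_mono hsub ht
  rw [ContinuousLinearMap.interior_preimage _ hsurj, interior_Iic] at h
  simpa [hf] using h

lemma nonempty_interior_simplex (m : ℕ) : (interior (simplex m)).Nonempty := by
  have hsub : {t : Coord m | (∀ i, 0 < t i) ∧ ∑ i, t i < 1} ⊆ interior (simplex m) := by
    refine interior_maximal (fun t ht => ⟨fun i => (ht.1 i).le, ht.2.le⟩) ?_
    have h : {t : Coord m | (∀ i, 0 < t i) ∧ ∑ i, t i < 1} =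
        (⋂ i, {t : Coord m | 0 < t i}) ∩ {t | ∑ i, t i < 1} := by
      ext t
      simp
    rw [h]
    exact (isOpen_iInter_of_finite fun i => isOpen_lt (by fun_prop) (by fun_prop)).inter
      (isOpen_lt (by fun_prop) (by fun_prop))
  -- The barycentre.
  refine ⟨WithLp.toLp 2 fun _ => ((m : ℝ) + 1)⁻¹, hsub ⟨fun i => ?_, ?_⟩⟩
  · simp only
    positivity
  · simp only [Finset.sum_const, Finset.card_univ, Fintype.card_fin, nsmul_eq_mul]
    rw [← div_eq_mul_inv, div_lt_one (by positivity)]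
    linarith

/-- Makes derivatives within the closed simplex unique, boundary points included. -/
lemma uniqueDiffOn_simplex (m : ℕ) : UniqueDiffOn ℝ (simplex m) :=
  uniqueDiffOn_convex (convex_simplex m) (nonempty_interior_simplex m)

lemma interior_simplex_ae_eq (m : ℕ) :
    interior (simplex m) =ᵐ[volume] simplex m :=
  interior_ae_eq_of_null_frontier ((convex_simplex m).addHaar_frontier volume)

end Simplex

/-! ### Barycentric coordinates and the combinatorics of facets -/

namespace PolygonalSpace

variable {m : ℕ} {V : Type*} [AddCommGroup V] [Module ℝ V] (A : PolygonalSpace m V)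

/-- The barycentric coordinates. -/
def barycentric (t : Coord m) : Fin (m + 1) → ℝ := Fin.cons (1 - ∑ i, t i) t

lemma sum_barycentric (t : Coord m) : ∑ i, barycentric t i = 1 := by
  simp [barycentric, Fin.sum_univ_succ]

lemma param_eq_sum (s : A.Facet) (t : Coord m) :
    A.param s t = ∑ i, barycentric t i • (A.vertex s i : V) := by
  simp only [param, barycentric, Fin.sum_univ_succ, Fin.cons_zero, Fin.cons_succ, smul_sub,
    Finset.sum_sub_distrib, sub_smul, one_smul, Finset.sum_smul]
  abel

lemma param_eq_sum_vertices (s : A.Facet) (t : Coord m) :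
    A.param s t = ∑ v : {v // v ∈ s.1}, barycentric t ((A.vertex s).symm v) • (v : V) := by
  rw [param_eq_sum, ← (A.vertex s).sum_comp]
  simp

lemma barycentric_nonneg {t : Coord m} (ht : t ∈ simplex m) (i : Fin (m + 1)) :
    0 ≤ barycentric t i := by
  refine Fin.cases ?_ (fun i => ?_) i
  · simpa [barycentric] using ht.2
  · simpa [barycentric] using ht.1 i

lemma barycentric_pos {t : Coord m} (ht : t ∈ interior (simplex m)) (i : Fin (m + 1)) :
    0 < barycentric t i := by
  refine Fin.cases ?_ (fun i => ?_) i
  · simpa [barycentric] using sum_lt_one_of_mem_interior_simplex ht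
  · simpa [barycentric] using pos_of_mem_interior_simplex ht i

lemma eq_weights (s : A.Facet) {w w' : {v // v ∈ s.1} → ℝ} (hw : ∑ v, w v = 1)
    (hw' : ∑ v, w' v = 1) (h : ∑ v, w v • (v : V) = ∑ v, w' v • (v : V)) : w = w' := by
  have hi := affineIndependent_iff.1 (A.complex.indep s.2.1) Finset.univ (fun v => w v - w' v)
    (by rw [Finset.sum_sub_distrib, hw, hw', sub_self])
    (by simp only [sub_smul]; rw [Finset.sum_sub_distrib, h, sub_self])
  funext v
  exact sub_eq_zero.1 (hi v (Finset.mem_univ v))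

lemma sum_barycentric_vertices (s : A.Facet) (t : Coord m) :
    ∑ v : {v // v ∈ s.1}, barycentric t ((A.vertex s).symm v) = 1 := by
  rw [(A.vertex s).symm.sum_comp, sum_barycentric]

lemma param_injective (s : A.Facet) : Function.Injective (A.param s) := by
  intro t t' h
  rw [param_eq_sum_vertices, param_eq_sum_vertices] at h
  have hw := A.eq_weights s (A.sum_barycentric_vertices s t) (A.sum_barycentric_vertices s t') h
  ext i
  have := congrFun hw (A.vertex s i.succ)
  simpa [barycentric] using this

lemma param_mem_convexHull (s : A.Facet) {t : Coord m} (ht : t ∈ simplex m) :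
    A.param s t ∈ convexHull ℝ (s.1 : Set V) := by
  rw [param_eq_sum]
  exact (convex_convexHull ℝ _).sum_mem (fun i _ => barycentric_nonneg ht i) (sum_barycentric t)
    fun i _ => subset_convexHull ℝ _ (A.vertex s i).2

lemma param_mem_space (s : A.Facet) {t : Coord m} (ht : t ∈ simplex m) :
    A.param s t ∈ A.complex.space :=
  Geometry.SimplicialComplex.convexHull_subset_space s.2.1 (A.param_mem_convexHull s ht)

/-- The common point lies in the hull of the common vertices. As an interior point of `s` it has all
barycentric coordinates positive, so uniqueness of weights makes every vertex of `s` a vertex of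
`s'`, and `s` is maximal. -/
lemma facet_eq_of_param_eq {s s' : A.Facet} {t t' : Coord m} (ht : t ∈ interior (simplex m))
    (ht' : t' ∈ simplex m) (h : A.param s t = A.param s' t') : s = s' := by
  classical
  have h1 : A.param s t ∈ convexHull ℝ ((s.1 ∩ s'.1 : Finset V) : Set V) := by
    rw [Finset.coe_inter, ← A.complex.convexHull_inter_convexHull s.2.1 s'.2.1]
    exact ⟨A.param_mem_convexHull s (interior_subset ht), h ▸ A.param_mem_convexHull s' ht'⟩
  obtain ⟨w, hw0, hw1, hw2⟩ := Finset.mem_convexHull'.1 h1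
  have hsub : s.1 ⊆ s'.1 := by
    intro v hv
    let w' : {v // v ∈ s.1} → ℝ := fun v => if (v : V) ∈ s'.1 then w v else 0
    have e1 : ∑ v, w' v = 1 := by
      rw [← hw1, ← Finset.filter_mem_eq_inter, Finset.sum_filter]
      exact Finset.sum_coe_sort s.1 (fun v => if v ∈ s'.1 then w v else 0)
    have e2 : ∑ v, w' v • (v : V) = A.param s t := by
      rw [← hw2, ← Finset.filter_mem_eq_inter, Finset.sum_filter]
      simp only [w', ite_smul, zero_smul]
      exact Finset.sum_coe_sort s.1 (fun v => if v ∈ s'.1 then w v • v else 0)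
    rw [param_eq_sum_vertices] at e2
    have := congrFun (A.eq_weights s e1 (A.sum_barycentric_vertices s t) e2) ⟨v, hv⟩
    by_contra hvs
    have hpos := barycentric_pos ht ((A.vertex s).symm ⟨v, hv⟩)
    simp only [w', if_neg hvs] at this
    exact hpos.ne this
  exact Subtype.ext (s.2.2 s'.2.1 hsub)

/-- Finiteness of the complex provides a maximal face above any face, so the facets cover the space.
-/
lemma exists_facet_of_mem_faces {s : Finset V} (hs : s ∈ A.complex.faces) :
    ∃ s' : A.Facet, s ⊆ s'.1 := by
  obtain ⟨s', hss', hmax⟩ := A.finite_faces.exists_le_maximal hs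
  exact ⟨⟨s', hmax.prop, fun t ht hst => le_antisymm hst (hmax.le_of_ge ht hst)⟩, hss'⟩

lemma exists_param_eq {x : V} (hx : x ∈ A.complex.space) :
    ∃ s : A.Facet, ∃ t ∈ simplex m, A.param s t = x := by
  obtain ⟨s₀, hs₀, hxs₀⟩ := Geometry.SimplicialComplex.mem_space_iff.1 hx
  obtain ⟨s, hs⟩ := A.exists_facet_of_mem_faces hs₀
  have hxs : x ∈ convexHull ℝ (s.1 : Set V) := convexHull_mono (by exact_mod_cast hs) hxs₀
  obtain ⟨w, hw0, hw1, hw2⟩ := Finset.mem_convexHull'.1 hxs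
  have e1 : ∑ i, w (A.vertex s i) = 1 := by
    rw [(A.vertex s).sum_comp (fun v => w v), Finset.sum_coe_sort s.1 w, hw1]
  have e1' : ∑ i : Fin m, w (A.vertex s i.succ) = 1 - w (A.vertex s 0) := by
    rw [← e1, Fin.sum_univ_succ]
    ring
  refine ⟨s, WithLp.toLp 2 fun i => w (A.vertex s i.succ), ⟨fun i => hw0 _ (A.vertex s _).2, ?_⟩, ?_⟩
  · simp only
    rw [e1']
    linarith [hw0 _ (A.vertex s 0).2]
  · have hb : barycentric (WithLp.toLp 2 fun i => w (A.vertex s i.succ)) =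
        fun i => w (A.vertex s i) := by
      funext i
      refine Fin.cases ?_ (fun i => ?_) i
      · simp only [barycentric, Fin.cons_zero]
        rw [e1']
        ring
      · simp [barycentric]
    rw [param_eq_sum, hb, (A.vertex s).sum_comp (fun v => w v • (v : V)),
      Finset.sum_coe_sort s.1 (fun v => w v • v), hw2]

end PolygonalSpace

/-! ### The map `φ` in charts -/

namespace PolygonalSpace

variable {m k l : ℕ} {V : Type*} [AddCommGroup V] [Module ℝ V] (A : PolygonalSpace m V)
  {H : Type*} [TopologicalSpace H] (I : ModelWithCorners ℝ (Coord m) H)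
  {M : Type*} [TopologicalSpace M] [ChartedSpace H M] (φ : V → M)

section Chart

/-- The map `φ` in the coordinates of a facet and of a chart. -/
def chartMap (s : A.Facet) (x₀ : M) (t : Coord m) : Coord m :=
  extChartAt I x₀ (A.localMap φ s t)

/-- The derivative of `chartMap`. -/
def chartDeriv (s : A.Facet) (x₀ : M) (t : Coord m) : Coord m →L[ℝ] Coord m :=
  fderivWithin ℝ (A.chartMap I φ s x₀) (simplex m) t

variable {A I φ} {o : ∀ x : M, Orientation ℝ (TangentSpace I x) (Fin m)}
  (hφ : A.IsOrientedDiffeo I φ o)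

include hφ

lemma IsOrientedDiffeo.continuousOn (s : A.Facet) : ContinuousOn (A.localMap φ s) (simplex m) :=
  (hφ.smooth s).continuousOn

variable [IsManifold I ∞ M]

lemma IsOrientedDiffeo.contMDiffWithinAt_chartMap (s : A.Facet) (x₀ : M) {t : Coord m}
    (ht : t ∈ simplex m) (hx : A.localMap φ s t ∈ (chartAt H x₀).source) :
    ContMDiffWithinAt 𝓘(ℝ, Coord m) 𝓘(ℝ, Coord m) ∞ (A.chartMap I φ s x₀) (simplex m) t :=
  (contMDiffAt_extChartAt' hx).comp_contMDiffWithinAt t (hφ.smooth s t ht)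

lemma IsOrientedDiffeo.hasFDerivWithinAt_chartMap (s : A.Facet) (x₀ : M) {t : Coord m}
    (ht : t ∈ simplex m) (hx : A.localMap φ s t ∈ (chartAt H x₀).source) :
    HasFDerivWithinAt (A.chartMap I φ s x₀) (A.chartDeriv I φ s x₀ t) (simplex m) t :=
  ((hφ.contMDiffWithinAt_chartMap s x₀ ht hx).contDiffWithinAt.differentiableWithinAt
    (by simp)).hasFDerivWithinAt

/-- Near `t`, `φ` is the inverse chart composed with `chartMap`, so this is the chain rule. It
expresses the tangent map in the coordinate frame of the chart. -/
lemma IsOrientedDiffeo.tangentMap_eq (s : A.Facet) (x₀ : M) {t : Coord m}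
    (ht : t ∈ simplex m) (hx : A.localMap φ s t ∈ (chartAt H x₀).source) (v : Coord m) :
    A.tangentMap I φ s t v =
      (mfderivWithin 𝓘(ℝ, Coord m) I (extChartAt I x₀).symm (range I) (A.chartMap I φ s x₀ t))
        (A.chartDeriv I φ s x₀ t v) := by
  have hev : A.localMap φ s =ᶠ[𝓝[simplex m] t] (extChartAt I x₀).symm ∘ A.chartMap I φ s x₀ := by
    have : ∀ᶠ t' in 𝓝[simplex m] t, A.localMap φ s t' ∈ (chartAt H x₀).source :=
      (hφ.continuousOn s t ht).eventually ((chartAt H x₀).open_source.mem_nhds hx)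
    filter_upwards [this] with t' ht'
    simp only [chartMap, Function.comp_apply]
    rw [(extChartAt I x₀).left_inv (by rwa [extChartAt_source])]
  have hU : UniqueMDiffWithinAt 𝓘(ℝ, Coord m) (simplex m) t :=
    (uniqueDiffOn_simplex m).uniqueMDiffOn t ht
  have htar : A.chartMap I φ s x₀ t ∈ (extChartAt I x₀).target :=
    (extChartAt I x₀).map_source (by rwa [extChartAt_source])
  have h1 : MDifferentiableWithinAt 𝓘(ℝ, Coord m) 𝓘(ℝ, Coord m) (A.chartMap I φ s x₀)
      (simplex m) t :=
    (hφ.contMDiffWithinAt_chartMap s x₀ ht hx).mdifferentiableWithinAt (by simp)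
  have h2 : MDifferentiableWithinAt 𝓘(ℝ, Coord m) I (extChartAt I x₀).symm (range I)
      (A.chartMap I φ s x₀ t) := mdifferentiableWithinAt_extChartAt_symm htar
  have h3 := mfderivWithin_comp t h2 h1
    (fun t' _ => (mem_range_self _ : A.chartMap I φ s x₀ t' ∈ range I)) hU
  rw [mfderivWithin_eq_fderivWithin] at h3
  exact (DFunLike.congr_fun (hev.mfderivWithin_eq_of_mem ht) v).trans (DFunLike.congr_fun h3 v)

/-- The tangent map as a linear isomorphism. -/
def IsOrientedDiffeo.tangentEquiv (s : A.Facet) {t : Coord m} (ht : t ∈ simplex m) :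
    Coord m ≃ₗ[ℝ] TangentSpace I (A.localMap φ s t) :=
  LinearEquiv.ofBijective (A.tangentMap I φ s t).toLinearMap (hφ.bijective s t ht)

lemma IsOrientedDiffeo.chartDeriv_injective (s : A.Facet) (x₀ : M) {t : Coord m}
    (ht : t ∈ simplex m) (hx : A.localMap φ s t ∈ (chartAt H x₀).source) :
    Function.Injective (A.chartDeriv I φ s x₀ t) := by
  intro v w hvw
  refine (hφ.bijective s t ht).1 ?_
  have h1 := hφ.tangentMap_eq s x₀ ht hx v
  have h2 := hφ.tangentMap_eq s x₀ ht hx w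
  rw [hvw] at h1
  exact h1.trans h2.symm

lemma IsOrientedDiffeo.det_chartDeriv_ne_zero (s : A.Facet) (x₀ : M) {t : Coord m}
    (ht : t ∈ simplex m) (hx : A.localMap φ s t ∈ (chartAt H x₀).source) :
    (A.chartDeriv I φ s x₀ t).det ≠ 0 := by
  have h := hφ.chartDeriv_injective s x₀ ht hx
  have h2 : IsUnit (A.chartDeriv I φ s x₀ t).toLinearMap :=
    (LinearMap.isUnit_iff_ker_eq_bot _).2 (LinearMap.ker_eq_bot.2 h)
  exact (h2.map LinearMap.det).ne_zero

omit [IsManifold I ∞ M] in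
lemma IsOrientedDiffeo.chartMap_injOn (s : A.Facet) (x₀ : M) :
    InjOn (A.chartMap I φ s x₀)
      (simplex m ∩ A.localMap φ s ⁻¹' (chartAt H x₀).source) := by
  rintro t ⟨ht, hx⟩ t' ⟨ht', hx'⟩ h
  have h1 : A.localMap φ s t = A.localMap φ s t' :=
    (extChartAt I x₀).injOn (by rwa [extChartAt_source]) (by rwa [extChartAt_source]) h
  exact A.param_injective s (hφ.bijOn.injOn (A.param_mem_space s ht) (A.param_mem_space s ht') h1)

omit [IsManifold I ∞ M] in
lemma IsOrientedDiffeo.localMap_injOn (s : A.Facet) : InjOn (A.localMap φ s) (simplex m) := by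
  intro t ht t' ht' h
  exact A.param_injective s (hφ.bijOn.injOn (A.param_mem_space s ht) (A.param_mem_space s ht') h)

omit [IsManifold I ∞ M] in
lemma IsOrientedDiffeo.facet_eq {s s' : A.Facet} {t t' : Coord m}
    (ht : t ∈ interior (simplex m)) (ht' : t' ∈ simplex m)
    (h : A.localMap φ s t = A.localMap φ s' t') : s = s' :=
  A.facet_eq_of_param_eq ht ht' (hφ.bijOn.injOn (A.param_mem_space s (interior_subset ht))
    (A.param_mem_space s' ht') h)

omit [IsManifold I ∞ M] in
lemma IsOrientedDiffeo.exists_localMap_eq (x : M) :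
    ∃ s : A.Facet, ∃ t ∈ simplex m, A.localMap φ s t = x := by
  obtain ⟨p, hp, rfl⟩ := hφ.bijOn.surjOn (mem_univ x)
  obtain ⟨s, t, ht, rfl⟩ := A.exists_param_eq hp
  exact ⟨s, t, ht, rfl⟩

-- The preimage chosen in `pushforward` is unique: its facet by `facet_eq`, then its coordinates by
-- injectivity on that facet.
omit [IsManifold I ∞ M] in
lemma IsOrientedDiffeo.pushforward_localMap (σ : A.Form k) (s : A.Facet) {t : Coord m}
    (ht : t ∈ interior (simplex m)) :
    A.pushforward I φ σ (A.localMap φ s t) =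
      (σ s t).compLinearMap (A.tangentMap I φ s t).inverse.toLinearMap := by
  have h : ∃ p : A.Facet × Coord m, p.2 ∈ interior (simplex m) ∧
    A.localMap φ p.1 p.2 = A.localMap φ s t := ⟨(s, t), ht, rfl⟩
  have h1 := h.choose_spec
  rw [pushforward, dif_pos h]
  have hs : h.choose = (s, t) := by
    have e1 : h.choose.1 = s := hφ.facet_eq h1.1 (interior_subset ht) h1.2
    have e2 := h1.2
    rw [e1] at e2
    exact Prod.ext e1 (hφ.localMap_injOn s (interior_subset h1.1) (interior_subset ht) e2)
  rw [hs]

omit [IsManifold I ∞ M] in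
lemma IsOrientedDiffeo.pullback_pushforward (σ : A.Form k) (s : A.Facet) {t : Coord m}
    (ht : t ∈ interior (simplex m)) :
    A.pullback I φ (A.pushforward I φ σ) s t = σ s t := by
  rw [pullback, hφ.pushforward_localMap σ s ht]
  ext v
  simp only [AlternatingMap.compLinearMap_apply]
  congr 1
  funext i
  -- `inverse` takes the default value `0` on a map that is not an equivalence, so the tangent map
  -- has to be exhibited as one.
  have : T2Space (TangentSpace I (A.localMap φ s t)) := inferInstanceAs (T2Space (Coord m))
  let e : Coord m ≃L[ℝ] TangentSpace I (A.localMap φ s t) :=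
    (hφ.tangentEquiv s (interior_subset ht)).toContinuousLinearEquiv
  have he : A.tangentMap I φ s t = (e : Coord m →L[ℝ] TangentSpace I (A.localMap φ s t)) := by
    ext v
    rfl
  change (A.tangentMap I φ s t).inverse (A.tangentMap I φ s t (v i)) = v i
  rw [he, ContinuousLinearMap.inverse_equiv]
  exact e.symm_apply_apply _

end Chart

/-! ### The pulled back metric -/

section PullMetric

variable [IsManifold I ∞ M]
  (g : ContMDiffRiemannianMetric I ∞ (Coord m) (fun x : M => TangentSpace I x))

/-- The metric of `M` at a point. -/
def metricLin (x : M) : TangentSpace I x →ₗ[ℝ] TangentSpace I x →ₗ[ℝ] ℝ :=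
  LinearMap.mk₂ ℝ (fun v w => HodgeAdjoint.metricAt I g x v w)
    (by simp [HodgeAdjoint.metricAt]) (by simp [HodgeAdjoint.metricAt])
    (by simp [HodgeAdjoint.metricAt]) (by simp [HodgeAdjoint.metricAt])

/-- The pull-back of the metric of `M` to a facet. -/
def pullMetric (s : A.Facet) (t v w : Coord m) : ℝ :=
  HodgeAdjoint.metricAt I g (A.localMap φ s t) (A.tangentMap I φ s t v) (A.tangentMap I φ s t w)

variable {A I φ} {o : ∀ x : M, Orientation ℝ (TangentSpace I x) (Fin m)}
  (hφ : A.IsOrientedDiffeo I φ o)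

include hφ

/-- The metric section along `φ` is evaluated on the images of two constant vector fields under the
tangent map. Continuity up to the boundary is what the later compactness argument needs. -/
lemma IsOrientedDiffeo.continuousOn_pullMetric (s : A.Facet) (v w : Coord m) :
    ContinuousOn (fun t => A.pullMetric I φ g s t v w) (simplex m) := by
  have hU : UniqueMDiffOn 𝓘(ℝ, Coord m) (simplex m) := (uniqueDiffOn_simplex m).uniqueMDiffOn
  have hT := (hφ.smooth s).contMDiffOn_tangentMapWithin (m := 0) (by simp) hU
  have hsec (v : Coord m) : ContMDiff 𝓘(ℝ, Coord m) 𝓘(ℝ, Coord m).tangent 0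
      (fun t => (⟨t, v⟩ : TangentBundle 𝓘(ℝ, Coord m) (Coord m))) := by
    intro t
    exact contMDiffAt_vectorSpace_iff_contDiffAt.2 contDiffAt_const
  have hTv (v : Coord m) : ContMDiffOn 𝓘(ℝ, Coord m) I.tangent 0
      (fun t => (⟨A.localMap φ s t, A.tangentMap I φ s t v⟩ : TangentBundle I M)) (simplex m) :=
    hT.comp (hsec v).contMDiffOn (fun t ht => ht)
  intro t ht
  have hg : ContMDiffWithinAt 𝓘(ℝ, Coord m)
      (I.prod 𝓘(ℝ, Coord m →L[ℝ] Coord m →L[ℝ] ℝ)) 0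
      (fun t => TotalSpace.mk' (Coord m →L[ℝ] Coord m →L[ℝ] ℝ)
        (E := fun x : M => (TangentSpace I x →L[ℝ] TangentSpace I x →L[ℝ] ℝ))
        (A.localMap φ s t) (g.inner (A.localMap φ s t))) (simplex m) t :=
    (g.contMDiff.of_le (by simp)).contMDiffAt.comp_contMDiffWithinAt t
      ((hφ.smooth s t ht).of_le (by simp))
  have key : ContMDiffWithinAt 𝓘(ℝ, Coord m) (I.prod 𝓘(ℝ)) 0
      (fun t => TotalSpace.mk' ℝ (E := Bundle.Trivial M ℝ) (A.localMap φ s t)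
        (A.pullMetric I φ g s t v w)) (simplex m) t :=
    ContMDiffWithinAt.clm_bundle_apply₂ (F₁ := Coord m) (F₂ := Coord m) hg (hTv v t ht) (hTv w t ht)
  rw [contMDiffWithinAt_totalSpace] at key
  exact key.2.continuousWithinAt

omit hφ in
variable (A I φ) in
/-- The pull-back of the metric of `M` to a facet, as a bilinear map. -/
def pullMetricLin (s : A.Facet) (t : Coord m) : Coord m →ₗ[ℝ] Coord m →ₗ[ℝ] ℝ :=
  (metricLin I g (A.localMap φ s t)).compl₁₂ (A.tangentMap I φ s t).toLinearMap
    (A.tangentMap I φ s t).toLinearMap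

omit hφ in
lemma posDef_gram_metricAt (s : A.Facet) {t : Coord m} (ht : t ∈ simplex m) :
    (gram (stdBasis m) (A.metricAt s t)).PosDef :=
  posDef_gram (stdBasis m) (A.metric s t) (A.metric_symm s t ht) (A.metric_pos s t ht)

lemma IsOrientedDiffeo.posDef_gram_pullMetric (s : A.Facet) {t : Coord m} (ht : t ∈ simplex m) :
    (gram (stdBasis m) (A.pullMetric I φ g s t)).PosDef :=
  posDef_gram (stdBasis m) (A.pullMetricLin I φ g s t) (fun _ _ => g.symm _ _ _)
    (fun _ hv => g.pos _ _ fun h => hv ((hφ.bijective s t ht).1 (h.trans (map_zero _).symm)))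

lemma IsOrientedDiffeo.pointwiseInner_localMap (u v : HodgeAdjoint.Form I M k) (s : A.Facet)
    {t : Coord m} (ht : t ∈ simplex m) :
    HodgeAdjoint.pointwiseInner I g u v (A.localMap φ s t) =
      formInner (stdBasis m) (A.pullMetric I φ g s t) (A.pullback I φ u s t)
        (A.pullback I φ v s t) :=
  formInner_comp (stdBasis m) (tangentBasis I (A.localMap φ s t)) (hφ.tangentEquiv s ht)
    (metricLin I g (A.localMap φ s t)) (u _) (v _)

/-- The tangent map is an isometry from the pulled back metric to `g`, so the star commutes with it
once it preserves orientation. -/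
lemma IsOrientedDiffeo.pullback_star (h : k + l = m) (τ : HodgeAdjoint.Form I M k) (s : A.Facet)
    {t : Coord m} (ht : t ∈ simplex m) :
    A.pullback I φ (HodgeAdjoint.star I g o h τ) s t =
      hodgeStar (stdBasis m) (A.pullMetric I φ g s t) (A.orientation s) h
        (A.pullback I φ τ s t) :=
  hodgeStar_comp (stdBasis m) (tangentBasis I (A.localMap φ s t)) (hφ.tangentEquiv s ht)
    (metricLin I g (A.localMap φ s t)) (A.orientation s) (o _) (hφ.orientation s t ht _) h (τ _)

omit hφ in
lemma sqrt_det_gram_comp (B : Coord m →ₗ[ℝ] Coord m →ₗ[ℝ] ℝ) (D : Coord m →L[ℝ] Coord m)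
    (hD : D.det ≠ 0) :
    Real.sqrt (gram (stdBasis m) (fun v w => B (D v) (D w))).det =
      |D.det| * Real.sqrt (gram (stdBasis m) (fun v w => B v w)).det := by
  let e : Coord m ≃ₗ[ℝ] Coord m := LinearMap.equivOfDetNeZero D.toLinearMap hD
  have h1 : gram (stdBasis m) (fun v w => B (D v) (D w)) =
      gram ((stdBasis m).map e) (fun v w => B v w) := by
    ext i j
    simp only [gram, Matrix.of_apply, Module.Basis.map_apply]
    rfl
  have h2 : (stdBasis m).det ((stdBasis m).map e) = D.det := by
    have := (stdBasis m).det_comp D.toLinearMap (stdBasis m)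
    rw [(stdBasis m).det_self, mul_one] at this
    exact this
  rw [h1, gram_basis_change (stdBasis m), Matrix.det_mul, Matrix.det_mul, Matrix.det_transpose,
    ← Module.Basis.det_apply, h2, ← Real.sqrt_sq_eq_abs, ← Real.sqrt_mul (sq_nonneg _)]
  congr 1
  ring

/-- The absolute determinant is the Jacobian of the passage from the facet to the chart, so the two
volume densities correspond under change of variables. -/
lemma IsOrientedDiffeo.sqrt_det_pullMetric (s : A.Facet) (x₀ : M) {t : Coord m}
    (ht : t ∈ simplex m) (hx : A.localMap φ s t ∈ (chartAt H x₀).source) :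
    Real.sqrt (gram (stdBasis m) (A.pullMetric I φ g s t)).det =
      |(A.chartDeriv I φ s x₀ t).det| * Real.sqrt (gram (coordFrame I x₀ (A.chartMap I φ s x₀ t))
        (HodgeAdjoint.metricAt I g
          ((extChartAt I x₀).symm (A.chartMap I φ s x₀ t)))).det := by
  let y := A.chartMap I φ s x₀ t
  let F : Coord m →L[ℝ] Coord m := mfderivWithin 𝓘(ℝ, Coord m) I (extChartAt I x₀).symm (range I) y
  let B : Coord m →ₗ[ℝ] Coord m →ₗ[ℝ] ℝ :=
    (metricLin I g ((extChartAt I x₀).symm y)).compl₁₂ F.toLinearMap F.toLinearMap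
  have hy : (extChartAt I x₀).symm y = A.localMap φ s t :=
    (extChartAt I x₀).left_inv (by rwa [extChartAt_source])
  have h1 := sqrt_det_gram_comp B (A.chartDeriv I φ s x₀ t) (hφ.det_chartDeriv_ne_zero s x₀ ht hx)
  have h2 : (fun v w => B (A.chartDeriv I φ s x₀ t v) (A.chartDeriv I φ s x₀ t w)) =
      A.pullMetric I φ g s t := by
    -- The two base points are equal only propositionally, so their tangent spaces are identified by
    -- substitution.
    have key (z : M) (hz : z = A.localMap φ s t) (v w : Coord m) :
        HodgeAdjoint.metricAt I g z v w = HodgeAdjoint.metricAt I g (A.localMap φ s t) v w := by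
      subst hz; rfl
    funext v w
    have e1 := hφ.tangentMap_eq s x₀ ht hx v
    have e2 := hφ.tangentMap_eq s x₀ ht hx w
    refine (key _ hy _ _).trans ?_
    exact congrArg₂ (HodgeAdjoint.metricAt I g (A.localMap φ s t)) e1.symm e2.symm
  rw [h2] at h1
  exact h1

end PullMetric

end PolygonalSpace

/-! ### Positivity of the inner product of forms -/

section FormInner

variable {W : Type*} [AddCommGroup W] [Module ℝ W] {m k : ℕ} (b : Module.Basis (Fin m) ℝ W)
  (B : W → W → ℝ)

lemma formInner_eq_dotProduct (α β : W [⋀^Fin k]→ₗ[ℝ] ℝ) :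
    formInner b B α β = (k.factorial : ℝ)⁻¹ * ((fun I => α (b ∘ I)) ⬝ᵥ
      (tensorPower k (gram b B)⁻¹).mulVec (fun J => β (b ∘ J))) := by
  rw [formInner, sum_dualGram_eq_dotProduct]

lemma formInner_smul_right (c : ℝ) (α β : W [⋀^Fin k]→ₗ[ℝ] ℝ) :
    formInner b B α (c • β) = c * formInner b B α β := by
  simp only [formInner, AlternatingMap.smul_apply, smul_eq_mul, Finset.mul_sum]
  refine Finset.sum_congr rfl fun I _ => Finset.sum_congr rfl fun J _ => by ring

lemma formInner_sub_left (α α' β : W [⋀^Fin k]→ₗ[ℝ] ℝ) :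
    formInner b B (α - α') β = formInner b B α β - formInner b B α' β := by
  simp only [formInner, AlternatingMap.sub_apply, mul_sub, sub_mul, Finset.sum_sub_distrib]

lemma formInner_sub_right (α β β' : W [⋀^Fin k]→ₗ[ℝ] ℝ) :
    formInner b B α (β - β') = formInner b B α β - formInner b B α β' := by
  simp only [formInner, AlternatingMap.sub_apply, mul_sub, Finset.sum_sub_distrib]

lemma formInner_add_left (α α' β : W [⋀^Fin k]→ₗ[ℝ] ℝ) :
    formInner b B (α + α') β = formInner b B α β + formInner b B α' β := by
  simp only [formInner, AlternatingMap.add_apply, mul_add, add_mul, Finset.sum_add_distrib]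

lemma formInner_add_right (α β β' : W [⋀^Fin k]→ₗ[ℝ] ℝ) :
    formInner b B α (β + β') = formInner b B α β + formInner b B α β' := by
  simp only [formInner, AlternatingMap.add_apply, mul_add, Finset.sum_add_distrib]

variable {b B} (hB : (gram b B).PosDef)

include hB

lemma formInner_symm (α β : W [⋀^Fin k]→ₗ[ℝ] ℝ) : formInner b B α β = formInner b B β α := by
  simp only [formInner]
  rw [Finset.sum_comm]
  congr 1
  refine Finset.sum_congr rfl fun I _ => Finset.sum_congr rfl fun J _ => ?_
  rw [dualGram_symm b B hB J I]
  ring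

/-- Stated for arbitrary component vectors, not only those of alternating forms, so that it applies
on a full unit sphere in `exists_formInner_le`. -/
lemma dotProduct_tensorPower_pos {c : (Fin k → Fin m) → ℝ} (hc : c ≠ 0) :
    0 < c ⬝ᵥ (tensorPower k (gram b B)⁻¹).mulVec c := by
  simpa using (posDef_tensorPower (k := k) hB.inv).dotProduct_mulVec_pos hc

lemma formInner_self_pos {α : W [⋀^Fin k]→ₗ[ℝ] ℝ} (hα : α ≠ 0) : 0 < formInner b B α α := by
  rw [formInner_eq_dotProduct]
  refine mul_pos (by positivity) (dotProduct_tensorPower_pos hB fun h => hα ?_)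
  refine Module.Basis.ext_alternating b fun I _ => ?_
  exact congrFun h I

lemma formInner_self_nonneg (α : W [⋀^Fin k]→ₗ[ℝ] ℝ) : 0 ≤ formInner b B α α := by
  by_cases hα : α = 0
  · simp [hα, formInner]
  · exact (formInner_self_pos hB hα).le

lemma formInner_self_eq_zero {α : W [⋀^Fin k]→ₗ[ℝ] ℝ} (h : formInner b B α α = 0) : α = 0 := by
  by_contra hα
  exact (formInner_self_pos hB hα).ne' h

/-- Expansion of the square of `α - β`. This inequality serves in place of Cauchy–Schwarz. -/
lemma two_mul_formInner_le (α β : W [⋀^Fin k]→ₗ[ℝ] ℝ) :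
    2 * formInner b B α β ≤ formInner b B α α + formInner b B β β := by
  have h := formInner_self_nonneg hB (α - β)
  rw [formInner_sub_left, formInner_sub_right, formInner_sub_right, formInner_symm hB β α] at h
  linarith

lemma two_mul_abs_formInner_le (α β : W [⋀^Fin k]→ₗ[ℝ] ℝ) :
    2 * |formInner b B α β| ≤ formInner b B α α + formInner b B β β := by
  have h := formInner_self_nonneg hB (α + β)
  rw [formInner_add_left, formInner_add_right, formInner_add_right, formInner_symm hB β α] at h
  have h2 := two_mul_formInner_le hB α β
  rcases abs_cases (formInner b B α β) with h3 | h3 <;> linarith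

end FormInner

/-! ### Continuous metrics on the simplex -/

section MetricField

variable {m k l : ℕ}

/-- A field of inner products on `ℝᵐ`, continuous on the standard simplex. -/
structure IsMetricField (B : Coord m → Coord m → Coord m → ℝ) : Prop where
  continuousOn : ∀ v w, ContinuousOn (fun t => B t v w) (simplex m)
  posDef : ∀ t ∈ simplex m, (gram (stdBasis m) (B t)).PosDef

/-- The volume density of a metric. -/
def density (B : Coord m → Coord m → Coord m → ℝ) (t : Coord m) : ℝ :=
  Real.sqrt (gram (stdBasis m) (B t)).det

/-- The volume of a metric on the standard simplex. -/
def fieldVolume (B : Coord m → Coord m → Coord m → ℝ) : Measure (Coord m) :=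
  (volume.restrict (simplex m)).withDensity fun t => ENNReal.ofReal (density B t)

/-- The form has measurable components on the standard simplex. -/
def HasMeasurableComponents (u : Coord m → Coord m [⋀^Fin k]→ₗ[ℝ] ℝ) : Prop :=
  ∀ J : Fin k → Fin m, AEMeasurable (fun t => u t (stdBasis m ∘ J)) (volume.restrict (simplex m))

namespace IsMetricField

variable {B B' : Coord m → Coord m → Coord m → ℝ} (hB : IsMetricField B)

include hB

lemma continuousOn_gram : ContinuousOn (fun t => gram (stdBasis m) (B t)) (simplex m) :=
  continuousOn_pi.2 fun _ => continuousOn_pi.2 fun _ => hB.continuousOn _ _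

lemma continuousOn_det : ContinuousOn (fun t => (gram (stdBasis m) (B t)).det) (simplex m) :=
  (continuous_id.matrix_det).comp_continuousOn hB.continuousOn_gram

lemma continuousOn_density : ContinuousOn (density B) (simplex m) := hB.continuousOn_det.sqrt

lemma density_pos {t : Coord m} (ht : t ∈ simplex m) : 0 < density B t :=
  Real.sqrt_pos.2 (hB.posDef t ht).det_pos

lemma continuousOn_inv_gram (i j : Fin m) :
    ContinuousOn (fun t => (gram (stdBasis m) (B t))⁻¹ i j) (simplex m) := by
  have h : ContinuousOn (fun t => (gram (stdBasis m) (B t)).adjugate i j) (simplex m) :=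
    ((continuous_id.matrix_adjugate).matrix_elem i j).comp_continuousOn hB.continuousOn_gram
  refine ((hB.continuousOn_det.inv₀ fun t ht => (hB.posDef t ht).det_pos.ne').mul h).congr
    fun t _ => ?_
  simp [Matrix.inv_def]

lemma continuousOn_dualGram (I J : Fin k → Fin m) :
    ContinuousOn (fun t => dualGram (stdBasis m) (B t) I J) (simplex m) :=
  continuousOn_finsetProd _ fun _ _ => hB.continuousOn_inv_gram _ _

lemma aemeasurable_density : AEMeasurable (density B) (volume.restrict (simplex m)) :=
  hB.continuousOn_density.aemeasurable (measurableSet_simplex m)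

lemma aemeasurable_dualGram (I J : Fin k → Fin m) :
    AEMeasurable (fun t => dualGram (stdBasis m) (B t) I J) (volume.restrict (simplex m)) :=
  (hB.continuousOn_dualGram I J).aemeasurable (measurableSet_simplex m)

lemma aemeasurable_formInner {u v : Coord m → Coord m [⋀^Fin k]→ₗ[ℝ] ℝ}
    (hu : HasMeasurableComponents u) (hv : HasMeasurableComponents v) :
    AEMeasurable (fun t => formInner (stdBasis m) (B t) (u t) (v t))
      (volume.restrict (simplex m)) :=
  (Finset.aemeasurable_fun_sum _ fun I _ => Finset.aemeasurable_fun_sum _ fun J _ =>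
    ((hB.aemeasurable_dualGram I J).mul (hu I)).mul (hv J)).const_mul _

lemma hasMeasurableComponents_hodgeStar {u : Coord m → Coord m [⋀^Fin k]→ₗ[ℝ] ℝ}
    (hu : HasMeasurableComponents u) (o : Orientation ℝ (Coord m) (Fin m)) (h : k + l = m) :
    HasMeasurableComponents fun t => hodgeStar (stdBasis m) (B t) o h (u t) := by
  intro K
  simp only [hodgeStar_apply, volForm_apply]
  exact (Finset.aemeasurable_fun_sum _ fun I _ => Finset.aemeasurable_fun_sum _ fun J _ =>
    ((hB.aemeasurable_dualGram I J).mul (hu I)).mul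
      ((hB.aemeasurable_density.const_mul _).mul_const _)).const_mul _

lemma integrable_fieldVolume_iff {f : Coord m → ℝ} :
    Integrable f (fieldVolume B) ↔ IntegrableOn (fun t => f t * density B t) (simplex m) := by
  rw [fieldVolume, integrable_withDensity_iff_integrable_smul₀'
    hB.aemeasurable_density.ennreal_ofReal (by simp)]
  refine integrableOn_congr_fun (fun t ht => ?_) (measurableSet_simplex m)
  simp only [smul_eq_mul]
  rw [ENNReal.toReal_ofReal (hB.density_pos ht).le, mul_comm]

lemma integral_fieldVolume (f : Coord m → ℝ) :
    ∫ t, f t ∂(fieldVolume B) = ∫ t in simplex m, f t * density B t := by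
  rw [fieldVolume, integral_withDensity_eq_integral_toReal_smul₀
    hB.aemeasurable_density.ennreal_ofReal (by simp)]
  refine setIntegral_congr_fun (measurableSet_simplex m) (fun t ht => ?_)
  simp only [smul_eq_mul]
  rw [ENNReal.toReal_ofReal (hB.density_pos ht).le, mul_comm]

/-- The density is positive on the simplex, so the null sets are those of Lebesgue measure, whatever
the metric. -/
lemma ae_fieldVolume_iff {p : Coord m → Prop} :
    (∀ᵐ t ∂(fieldVolume B), p t) ↔ ∀ᵐ t ∂(volume.restrict (simplex m)), p t := by
  refine ⟨fun h => ?_, fun h => withDensity_absolutelyContinuous _ _ h⟩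
  refine withDensity_absolutelyContinuous' hB.aemeasurable_density.ennreal_ofReal ?_ h
  filter_upwards [ae_restrict_mem (measurableSet_simplex m)] with t ht
  simpa using hB.density_pos ht

lemma integrable_formInner {u v : Coord m → Coord m [⋀^Fin k]→ₗ[ℝ] ℝ}
    (hu : HasMeasurableComponents u) (hv : HasMeasurableComponents v)
    (hui : Integrable (fun t => formInner (stdBasis m) (B t) (u t) (u t)) (fieldVolume B))
    (hvi : Integrable (fun t => formInner (stdBasis m) (B t) (v t) (v t)) (fieldVolume B)) :
    Integrable (fun t => formInner (stdBasis m) (B t) (u t) (v t)) (fieldVolume B) := by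
  refine (hui.add hvi).mono' ((hB.aemeasurable_formInner hu hv).mono_ac
    (withDensity_absolutelyContinuous _ _)).aestronglyMeasurable ?_
  rw [hB.ae_fieldVolume_iff]
  filter_upwards [ae_restrict_mem (measurableSet_simplex m)] with t ht
  have h := two_mul_abs_formInner_le (hB.posDef t ht) (u t) (v t)
  rw [Real.norm_eq_abs]
  change _ ≤ formInner (stdBasis m) (B t) (u t) (u t) + formInner (stdBasis m) (B t) (v t) (v t)
  linarith [abs_nonneg (formInner (stdBasis m) (B t) (u t) (v t))]

/-- The inner products of forms of two metrics, weighted with the volume densities, are uniformly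
comparable. -/
lemma exists_formInner_le (hB' : IsMetricField B') (k : ℕ) : ∃ C : ℝ, 0 < C ∧
    ∀ t ∈ simplex m, ∀ α : Coord m [⋀^Fin k]→ₗ[ℝ] ℝ,
      formInner (stdBasis m) (B' t) α α * density B' t ≤
        C * (formInner (stdBasis m) (B t) α α * density B t) := by
  -- The weighted square norm as a function of the point and the component vector. The quotient of
  -- the two such functions is continuous on the compact product of simplex and unit sphere, hence
  -- bounded above.
  let q (B : Coord m → Coord m → Coord m → ℝ) (p : Coord m × ((Fin k → Fin m) → ℝ)) : ℝ :=
    (p.2 ⬝ᵥ (tensorPower k (gram (stdBasis m) (B p.1))⁻¹).mulVec p.2) * density B p.1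
  have hcont {B : Coord m → Coord m → Coord m → ℝ} (hB : IsMetricField B) :
      ContinuousOn (q B) (simplex m ×ˢ Metric.sphere (0 : (Fin k → Fin m) → ℝ) 1) := by
    have hfst : MapsTo (Prod.fst : Coord m × ((Fin k → Fin m) → ℝ) → Coord m)
        (simplex m ×ˢ Metric.sphere (0 : (Fin k → Fin m) → ℝ) 1) (simplex m) := fun p hp => hp.1
    have h1 (I : Fin k → Fin m) : Continuous
        fun p : Coord m × ((Fin k → Fin m) → ℝ) => p.2 I := by fun_prop
    refine ContinuousOn.mul ?_ (hB.continuousOn_density.comp continuousOn_fst hfst)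
    refine continuousOn_finsetSum _ fun I _ => (h1 I).continuousOn.mul ?_
    refine continuousOn_finsetSum _ fun J _ => ContinuousOn.mul ?_ (h1 J).continuousOn
    exact (hB.continuousOn_dualGram I J).comp continuousOn_fst hfst
  have hpos {B : Coord m → Coord m → Coord m → ℝ} (hB : IsMetricField B)
      (p : Coord m × ((Fin k → Fin m) → ℝ))
      (hp : p ∈ simplex m ×ˢ Metric.sphere (0 : (Fin k → Fin m) → ℝ) 1) :
      0 < q B p :=
    mul_pos (dotProduct_tensorPower_pos (hB.posDef _ hp.1) (Metric.ne_of_mem_sphere hp.2 one_ne_zero))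
      (hB.density_pos hp.1)
  obtain ⟨C, hC⟩ := ((isCompact_simplex m).prod (isCompact_sphere _ _)).bddAbove_image
    ((hcont hB').div (hcont hB) fun p hp => (hpos hB p hp).ne')
  -- The maximum with `1` ensures positivity even if the sphere is empty.
  refine ⟨max C 1, by positivity, fun t ht α => ?_⟩
  let c : (Fin k → Fin m) → ℝ := fun I => α (stdBasis m ∘ I)
  have hq (B : Coord m → Coord m → Coord m → ℝ) :
      formInner (stdBasis m) (B t) α α * density B t = (k.factorial : ℝ)⁻¹ * q B (t, c) := by
    rw [formInner_eq_dotProduct, mul_assoc]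
  rw [hq, hq, mul_left_comm (max C 1)]
  suffices h : q B' (t, c) ≤ max C 1 * q B (t, c) from
    mul_le_mul_of_nonneg_left h (inv_nonneg.2 (Nat.cast_nonneg _))
  by_cases hc : c = 0
  · simp [q, hc]
  have hn : ‖c‖ ≠ 0 := norm_ne_zero_iff.2 hc
  have hmem : (t, ‖c‖⁻¹ • c) ∈ simplex m ×ˢ Metric.sphere (0 : (Fin k → Fin m) → ℝ) 1 :=
    ⟨ht, by simp [norm_smul, hn]⟩
  have h1 : q B' (t, ‖c‖⁻¹ • c) ≤ max C 1 * q B (t, ‖c‖⁻¹ • c) := by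
    have h2 : q B' (t, ‖c‖⁻¹ • c) / q B (t, ‖c‖⁻¹ • c) ≤ C := hC (mem_image_of_mem _ hmem)
    rw [div_le_iff₀ (hpos hB _ hmem)] at h2
    exact h2.trans (mul_le_mul_of_nonneg_right (le_max_left _ _) (hpos hB _ hmem).le)
  -- Homogeneity of degree two extends the bound from the unit sphere to all component vectors.
  have hhom (B : Coord m → Coord m → Coord m → ℝ) :
      q B (t, ‖c‖⁻¹ • c) = (‖c‖⁻¹ * ‖c‖⁻¹) * q B (t, c) := by
    simp only [q, Matrix.mulVec_smul, dotProduct_smul, smul_dotProduct, smul_eq_mul]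
    ring
  rw [hhom, hhom, mul_left_comm (max C 1)] at h1
  have hn' : 0 < ‖c‖⁻¹ := inv_pos.2 (norm_pos_iff.2 hc)
  exact le_of_mul_le_mul_left h1 (mul_pos hn' hn')

end IsMetricField

end MetricField

/-! ### The Riemannian volume as a sum over facets -/

namespace PolygonalSpace

variable {m k l : ℕ} {V : Type*} [AddCommGroup V] [Module ℝ V] (A : PolygonalSpace m V)
  {H : Type*} [TopologicalSpace H] (I : ModelWithCorners ℝ (Coord m) H)
  {M : Type*} [TopologicalSpace M] [ChartedSpace H M] (φ : V → M)

section Volume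

/-- The part of the open simplex that is mapped to the domain of the chart around `x₀`. -/
def chartDomain (s : A.Facet) (x₀ : M) : Set (Coord m) :=
  interior (simplex m) ∩ A.localMap φ s ⁻¹' (chartAt H x₀).source

variable [IsManifold I ∞ M]
  (g : ContMDiffRiemannianMetric I ∞ (Coord m) (fun x : M => TangentSpace I x))

/-- The image in `M` of the Riemannian volume of the pulled back metric. -/
def imageVolume [MeasurableSpace M] (s : A.Facet) : Measure M :=
  Measure.map ((interior (simplex m)).domRestrict (A.localMap φ s))
    (Measure.comap Subtype.val (fieldVolume (A.pullMetric I φ g s)))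

variable {A I φ} {o : ∀ x : M, Orientation ℝ (TangentSpace I x) (Fin m)}
  (hφ : A.IsOrientedDiffeo I φ o)

include hφ

omit [IsManifold I ∞ M] in
lemma IsOrientedDiffeo.isOpen_chartDomain (s : A.Facet) (x₀ : M) :
    IsOpen (A.chartDomain (H := H) φ s x₀) :=
  ((hφ.continuousOn s).mono interior_subset).isOpen_inter_preimage isOpen_interior
    (chartAt H x₀).open_source

lemma IsOrientedDiffeo.hasFDerivWithinAt_chartDomain (s : A.Facet) (x₀ : M) {S : Set (Coord m)}
    (hS : S ⊆ A.chartDomain (H := H) φ s x₀) (t : Coord m) (ht : t ∈ S) :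
    HasFDerivWithinAt (A.chartMap I φ s x₀) (A.chartDeriv I φ s x₀ t) S t :=
  (hφ.hasFDerivWithinAt_chartMap s x₀ (interior_subset (hS ht).1) (hS ht).2).mono
    fun _ h => interior_subset (hS h).1

omit [IsManifold I ∞ M] in
lemma IsOrientedDiffeo.injOn_chartDomain (s : A.Facet) (x₀ : M) :
    InjOn (A.chartMap I φ s x₀) (A.chartDomain (H := H) φ s x₀) :=
  (hφ.chartMap_injOn s x₀).mono (inter_subset_inter_left _ interior_subset)

omit hφ [IsManifold I ∞ M] in
lemma symm_chartMap (s : A.Facet) (x₀ : M) {t : Coord m}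
    (ht : A.localMap φ s t ∈ (chartAt H x₀).source) :
    (extChartAt I x₀).symm (A.chartMap I φ s x₀ t) = A.localMap φ s t :=
  (extChartAt I x₀).left_inv (by rwa [extChartAt_source])

omit [IsManifold I ∞ M] in
lemma IsOrientedDiffeo.disjoint_image_chartDomain (x₀ : M) {s s' : A.Facet} (hs : s ≠ s') :
    Disjoint (A.chartMap I φ s x₀ '' A.chartDomain (H := H) φ s x₀)
      (A.chartMap I φ s' x₀ '' A.chartDomain (H := H) φ s' x₀) := by
  rw [Set.disjoint_left]
  rintro _ ⟨t, ht, rfl⟩ ⟨t', ht', h⟩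
  refine hs (hφ.facet_eq ht.1 (interior_subset ht'.1) ?_)
  rw [← symm_chartMap (I := I) s x₀ ht.2, ← h, symm_chartMap (I := I) s' x₀ ht'.2]

/-- The target of a chart is covered, up to a null set, by the images of the open simplices. -/
lemma IsOrientedDiffeo.target_ae_le (x₀ : M) :
    (extChartAt I x₀).target ≤ᵐ[volume]
      ⋃ s, A.chartMap I φ s x₀ '' A.chartDomain (H := H) φ s x₀ := by
  let N : A.Facet → Set (Coord m) := fun s =>
    frontier (simplex m) ∩ A.localMap φ s ⁻¹' (chartAt H x₀).source
  -- The frontier of a convex set is null, and differentiable maps between spaces of equal dimension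
  -- preserve null sets.
  have hN (s : A.Facet) : volume (A.chartMap I φ s x₀ '' (simplex m ∩ N s)) = 0 := by
    refine addHaar_image_eq_zero_of_differentiableOn_of_addHaar_eq_zero volume ?_ ?_
    · intro t ht
      exact (hφ.hasFDerivWithinAt_chartMap s x₀ ht.1 ht.2.2).differentiableWithinAt.mono
        inter_subset_left
    · exact measure_mono_null (fun t ht => ht.2.1) ((convex_simplex m).addHaar_frontier volume)
  have hN' : volume (⋃ s, A.chartMap I φ s x₀ '' (simplex m ∩ N s)) = 0 :=
    measure_iUnion_null hN
  rw [ae_le_set]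
  refine measure_mono_null ?_ hN'
  rintro y ⟨hy, hy'⟩
  obtain ⟨s, t, ht, hst⟩ := hφ.exists_localMap_eq ((extChartAt I x₀).symm y)
  have hsrc : A.localMap φ s t ∈ (chartAt H x₀).source := by
    rw [hst, ← extChartAt_source I]
    exact (extChartAt I x₀).map_target hy
  have hyt : A.chartMap I φ s x₀ t = y := by
    rw [chartMap, hst, (extChartAt I x₀).right_inv hy]
  have hti : t ∉ interior (simplex m) := fun h =>
    hy' (mem_iUnion.2 ⟨s, t, ⟨h, hsrc⟩, hyt⟩)
  exact mem_iUnion.2 ⟨s, t, ⟨ht, ⟨subset_closure ht, hti⟩, hsrc⟩, hyt⟩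

omit hφ [IsManifold I ∞ M] in
lemma chartMap_mem_target (s : A.Facet) (x₀ : M) {t : Coord m}
    (ht : A.localMap φ s t ∈ (chartAt H x₀).source) :
    A.chartMap I φ s x₀ t ∈ (extChartAt I x₀).target :=
  (extChartAt I x₀).map_source (by rwa [extChartAt_source])

omit hφ [IsManifold I ∞ M] in
lemma measurableSet_extChartAt_target (x₀ : M) : MeasurableSet (extChartAt I x₀).target := by
  rw [extChartAt_target]
  exact (((chartAt H x₀).open_target.preimage I.continuous_symm).measurableSet).inter
    I.isClosed_range.measurableSet

variable [T2Space M] [MeasurableSpace M] [BorelSpace M]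

-- Lusin–Souslin: a continuous injective map on a Borel subset of a Polish space sends Borel sets to
-- Borel sets.
omit [IsManifold I ∞ M] in
lemma IsOrientedDiffeo.measurableEmbedding_localMap (s : A.Facet) :
    MeasurableEmbedding ((interior (simplex m)).domRestrict (A.localMap φ s)) :=
  ((hφ.continuousOn s).mono interior_subset).measurableEmbedding isOpen_interior.measurableSet
    ((hφ.localMap_injOn s).mono interior_subset)

omit [IsManifold I ∞ M] in
lemma IsOrientedDiffeo.measurableSet_inter_preimage (s : A.Facet) {E : Set M}
    (hE : MeasurableSet E) :
    MeasurableSet (interior (simplex m) ∩ A.localMap φ s ⁻¹' E) := by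
  have h := (MeasurableEmbedding.subtype_coe
    (isOpen_interior (s := simplex m)).measurableSet).measurableSet_image.2
    ((hφ.measurableEmbedding_localMap s).measurable hE)
  rwa [Set.domRestrict_eq, preimage_comp, Subtype.image_preimage_coe] at h

lemma IsOrientedDiffeo.imageVolume_apply (s : A.Facet) (E : Set M) :
    A.imageVolume I φ g s E =
      ∫⁻ t in interior (simplex m) ∩ A.localMap φ s ⁻¹' E,
        ENNReal.ofReal (density (A.pullMetric I φ g s) t) := by
  rw [imageVolume, (hφ.measurableEmbedding_localMap s).map_apply,
    (MeasurableEmbedding.subtype_coe isOpen_interior.measurableSet).comap_apply,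
    Set.domRestrict_eq, preimage_comp, Subtype.image_preimage_coe, fieldVolume, withDensity_apply',
    Measure.restrict_restrict' (measurableSet_simplex m)]
  congr 2
  exact inter_eq_left.2 fun t ht => interior_subset ht.1

/-- Up to a null set the chart target is the disjoint union of the images of the open simplices. On
each piece the Jacobian turns the chart density into that of the pulled back metric. -/
lemma IsOrientedDiffeo.chartVolume_apply (x₀ : M) {E : Set M} (hE : MeasurableSet E) :
    chartVolume I g x₀ E =
      ∑ s, A.imageVolume I φ g s (E ∩ (chartAt H x₀).source) := by
  let S : A.Facet → Set (Coord m) := fun s =>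
    interior (simplex m) ∩ A.localMap φ s ⁻¹' (E ∩ (chartAt H x₀).source)
  have hSsub (s : A.Facet) : S s ⊆ A.chartDomain (H := H) φ s x₀ := fun t ht => ⟨ht.1, ht.2.2⟩
  have hSm (s : A.Facet) : MeasurableSet (S s) :=
    hφ.measurableSet_inter_preimage s (hE.inter (chartAt H x₀).open_source.measurableSet)
  have hder (s : A.Facet) := hφ.hasFDerivWithinAt_chartDomain s x₀ (hSsub s)
  have hinj (s : A.Facet) := (hφ.injOn_chartDomain s x₀).mono (hSsub s)
  have hset : ((extChartAt I x₀).symm ⁻¹' E ∩ (extChartAt I x₀).target : Set (Coord m)) =ᵐ[volume]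
      ⋃ s, A.chartMap I φ s x₀ '' S s := by
    refine Filter.EventuallyLE.antisymm ?_ (LE.le.eventuallyLE ?_)
    · filter_upwards [hφ.target_ae_le x₀] with y hy hyE
      obtain ⟨s, t, ht, rfl⟩ := mem_iUnion.1 (hy hyE.2)
      refine mem_iUnion.2 ⟨s, t, ⟨ht.1, ?_, ht.2⟩, rfl⟩
      have := hyE.1
      rwa [mem_preimage, symm_chartMap (I := I) s x₀ ht.2] at this
    · intro y hy
      obtain ⟨s, t, ht, rfl⟩ := mem_iUnion.1 hy
      refine ⟨?_, chartMap_mem_target s x₀ ht.2.2⟩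
      rw [mem_preimage, symm_chartMap (I := I) s x₀ ht.2.2]
      exact ht.2.1
  have hae : AEMeasurable (extChartAt I x₀).symm
      ((volume.restrict (extChartAt I x₀).target).withDensity fun y =>
        ENNReal.ofReal (Real.sqrt (gram (coordFrame I x₀ y)
          (HodgeAdjoint.metricAt I g ((extChartAt I x₀).symm y))).det)) :=
    ((continuousOn_extChartAt_symm x₀).aemeasurable
      (measurableSet_extChartAt_target x₀)).mono_ac (withDensity_absolutelyContinuous _ _)
  rw [chartVolume, Measure.map_apply_of_aemeasurable hae hE, withDensity_apply',
    Measure.restrict_restrict' (measurableSet_extChartAt_target x₀), setLIntegral_congr hset,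
    lintegral_iUnion (fun s => measurable_image_of_fderivWithin (hSm s) (hder s) (hinj s))
      (fun s s' hss' => (hφ.disjoint_image_chartDomain x₀ hss').mono (image_mono (hSsub s))
        (image_mono (hSsub s'))), tsum_fintype]
  refine Finset.sum_congr rfl fun s _ => ?_
  rw [lintegral_image_eq_lintegral_abs_det_fderiv_mul volume (hSm s) (hder s) (hinj s),
    hφ.imageVolume_apply]
  refine setLIntegral_congr_fun (hSm s) fun t ht => ?_
  rw [density, hφ.sqrt_det_pullMetric g s x₀ (interior_subset ht.1) ht.2.2,
    ENNReal.ofReal_mul (abs_nonneg _)]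

/-- Each chart measure is the restriction of the sum to the chart domain. Hence the supremum is at
most the sum, and on every chart domain it is at least the sum; finitely many such domains cover
`M`. -/
lemma IsOrientedDiffeo.riemannianVolume_eq_sum [CompactSpace M] :
    riemannianVolume I g = ∑ s, A.imageVolume I φ g s := by
  have happ (x₀ : M) {E : Set M} (hE : MeasurableSet E) : chartVolume I g x₀ E =
      (∑ s, A.imageVolume I φ g s) (E ∩ (chartAt H x₀).source) := by
    rw [hφ.chartVolume_apply g x₀ hE, Measure.finsetSum_apply]
  have hle : riemannianVolume I g ≤ ∑ s, A.imageVolume I φ g s := by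
    refine iSup_le fun x₀ => Measure.le_iff.2 fun E hE => ?_
    rw [happ x₀ hE]
    exact measure_mono inter_subset_left
  obtain ⟨T, hT⟩ := isCompact_univ.elim_finite_subcover (fun x : M => (chartAt H x).source)
    (fun x => (chartAt H x).open_source) (fun x _ => mem_iUnion.2 ⟨x, mem_chart_source H x⟩)
  have hcover : ⋃ x : T, (chartAt H (x : M)).source = univ := by
    refine eq_univ_of_univ_subset (hT.trans ?_)
    intro y hy
    obtain ⟨x, hx, hxy⟩ := mem_iUnion₂.1 hy
    exact mem_iUnion.2 ⟨⟨x, hx⟩, hxy⟩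
  refine (Measure.ext_iff_of_iUnion_eq_univ hcover).2 fun x => ?_
  have hsrc := (chartAt H (x : M)).open_source.measurableSet
  ext E hE
  rw [Measure.restrict_apply hE, Measure.restrict_apply hE]
  refine le_antisymm (hle _) ?_
  have h1 := happ x (hE.inter hsrc)
  rw [inter_assoc, inter_self] at h1
  rw [← h1]
  exact le_iSup (fun x₀ : M => chartVolume I g x₀) (x : M) _

omit hφ in
lemma isMetricField_metricAt (s : A.Facet) : IsMetricField (A.metricAt s) where
  continuousOn v w := (A.metric_smooth s v w).continuousOn
  posDef _ ht := posDef_gram_metricAt s ht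

omit [T2Space M] [MeasurableSpace M] [BorelSpace M] in
lemma IsOrientedDiffeo.isMetricField_pullMetric (s : A.Facet) :
    IsMetricField (A.pullMetric I φ g s) where
  continuousOn := hφ.continuousOn_pullMetric g s
  posDef _ ht := hφ.posDef_gram_pullMetric g s ht

omit hφ [T2Space M] [MeasurableSpace M] [BorelSpace M] in
lemma fieldVolume_restrict_interior (B : Coord m → Coord m → Coord m → ℝ) :
    (fieldVolume B).restrict (interior (simplex m)) = fieldVolume B := by
  refine Measure.restrict_eq_self_of_ae_mem ?_
  refine withDensity_absolutelyContinuous _ _ ?_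
  have h := ae_restrict_mem (μ := volume) (measurableSet_simplex m)
  have h2 := ae_restrict_of_ae (s := simplex m) (interior_simplex_ae_eq m).mem_iff
  filter_upwards [h, h2] with t ht ht2
  exact ht2.2 ht

lemma IsOrientedDiffeo.integrable_imageVolume_iff (s : A.Facet) {f : M → ℝ} :
    Integrable f (A.imageVolume I φ g s) ↔
      Integrable (fun t => f (A.localMap φ s t)) (fieldVolume (A.pullMetric I φ g s)) := by
  rw [imageVolume, (hφ.measurableEmbedding_localMap s).integrable_map_iff,
    ← fieldVolume_restrict_interior (A.pullMetric I φ g s),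
    ← map_comap_subtype_coe isOpen_interior.measurableSet,
    (MeasurableEmbedding.subtype_coe isOpen_interior.measurableSet).integrable_map_iff,
    map_comap_subtype_coe isOpen_interior.measurableSet, fieldVolume_restrict_interior]
  rfl

lemma IsOrientedDiffeo.integral_imageVolume (s : A.Facet) (f : M → ℝ) :
    ∫ x, f x ∂(A.imageVolume I φ g s) =
      ∫ t, f (A.localMap φ s t) ∂(fieldVolume (A.pullMetric I φ g s)) := by
  rw [imageVolume, (hφ.measurableEmbedding_localMap s).integral_map]
  conv_rhs => rw [← fieldVolume_restrict_interior (A.pullMetric I φ g s),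
    ← map_comap_subtype_coe isOpen_interior.measurableSet,
    (MeasurableEmbedding.subtype_coe isOpen_interior.measurableSet).integral_map]
  rfl

lemma IsOrientedDiffeo.integrable_riemannianVolume_iff [CompactSpace M] {f : M → ℝ} :
    Integrable f (riemannianVolume I g) ↔ ∀ s, Integrable (fun t => f (A.localMap φ s t))
      (fieldVolume (A.pullMetric I φ g s)) := by
  simp only [hφ.riemannianVolume_eq_sum g, integrable_finsetSum_measure, Finset.mem_univ,
    forall_const, hφ.integrable_imageVolume_iff]

lemma IsOrientedDiffeo.integral_riemannianVolume [CompactSpace M] {f : M → ℝ}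
    (hf : Integrable f (riemannianVolume I g)) :
    ∫ x, f x ∂(riemannianVolume I g) =
      ∑ s, ∫ t, f (A.localMap φ s t) ∂(fieldVolume (A.pullMetric I φ g s)) := by
  rw [hφ.riemannianVolume_eq_sum g] at hf ⊢
  rw [integral_finsetSum_measure (integrable_finsetSum_measure.1 hf)]
  exact Finset.sum_congr rfl fun s _ => hφ.integral_imageVolume g s f

end Volume

end PolygonalSpace

/-! ### Measurability of pull-backs and push-forwards -/

lemma aemeasurable_image_iff {m : ℕ} {f : Coord m → Coord m} {f' : Coord m → Coord m →L[ℝ] Coord m}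
    {S : Set (Coord m)} (hS : MeasurableSet S) (hf : ∀ t ∈ S, HasFDerivWithinAt f (f' t) S t)
    (hinj : InjOn f S) (hdet : ∀ t ∈ S, (f' t).det ≠ 0) (h : Coord m → ℝ) :
    AEMeasurable h (volume.restrict (f '' S)) ↔
      AEMeasurable (fun t => h (f t)) (volume.restrict S) := by
  -- Lebesgue measure on the image is the push-forward of `|det f'| dt`, which has the same null
  -- sets as `dt` because the determinant does not vanish.
  have hd := aemeasurable_ofReal_abs_det_fderivWithin volume hS hf
  rw [← restrict_map_withDensity_abs_det_fderiv_eq_addHaar volume hS hf hinj,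
    (measurableEmbedding_of_fderivWithin hS hf hinj).aemeasurable_map_iff]
  have h1 : h ∘ S.domRestrict f = (fun t => h (f t)) ∘ Subtype.val := rfl
  rw [h1, ← (MeasurableEmbedding.subtype_coe hS).aemeasurable_map_iff, map_comap_subtype_coe hS,
    restrict_withDensity hS]
  refine ⟨fun H => H.mono_ac (withDensity_absolutelyContinuous' hd ?_),
    fun H => H.mono_ac (withDensity_absolutelyContinuous _ _)⟩
  filter_upwards [ae_restrict_mem hS] with t ht
  simpa using hdet t ht

namespace PolygonalSpace

variable {m k l : ℕ} {V : Type*} [AddCommGroup V] [Module ℝ V] (A : PolygonalSpace m V)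
  {H : Type*} [TopologicalSpace H] (I : ModelWithCorners ℝ (Coord m) H)
  {M : Type*} [TopologicalSpace M] [ChartedSpace H M] (φ : V → M)

section Measurability

/-- The matrix of `chartDeriv`. -/
def chartMatrix (s : A.Facet) (x₀ : M) (t : Coord m) : Matrix (Fin m) (Fin m) ℝ :=
  Matrix.of fun i j => A.chartDeriv I φ s x₀ t (stdBasis m j) i

variable {A I φ} {o : ∀ x : M, Orientation ℝ (TangentSpace I x) (Fin m)}
  (hφ : A.IsOrientedDiffeo I φ o)

lemma sum_coord_smul_stdBasis (v : Coord m) : ∑ i, v i • stdBasis m i = v :=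
  (stdBasis m).sum_repr v

lemma det_chartMatrix (s : A.Facet) (x₀ : M) (t : Coord m) :
    (A.chartMatrix I φ s x₀ t).det = (A.chartDeriv I φ s x₀ t).det := by
  have h : A.chartMatrix I φ s x₀ t =
      LinearMap.toMatrix (stdBasis m) (stdBasis m) (A.chartDeriv I φ s x₀ t).toLinearMap := by
    ext i j
    rw [LinearMap.toMatrix_apply]
    rfl
  rw [h, LinearMap.det_toMatrix]

include hφ

variable [IsManifold I ∞ M]

lemma IsOrientedDiffeo.continuousOn_chartMatrix (s : A.Facet) (x₀ : M) :
    ContinuousOn (A.chartMatrix I φ s x₀) (A.chartDomain (H := H) φ s x₀) := by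
  have hopen := hφ.isOpen_chartDomain s x₀
  have hsub : A.chartDomain (H := H) φ s x₀ ⊆ simplex m := fun t ht => interior_subset ht.1
  have hcd : ContDiffOn ℝ ∞ (A.chartMap I φ s x₀) (A.chartDomain (H := H) φ s x₀) := fun t ht =>
    (hφ.contMDiffWithinAt_chartMap s x₀ (hsub ht) ht.2).contDiffWithinAt.mono hsub
  have hfd := hcd.continuousOn_fderiv_of_isOpen hopen (by simp)
  have hD : ContinuousOn (A.chartDeriv I φ s x₀) (A.chartDomain (H := H) φ s x₀) :=
    hfd.congr fun t ht => fderivWithin_of_mem_nhds (mem_interior_iff_mem_nhds.1 ht.1)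
  refine continuousOn_pi.2 fun i => continuousOn_pi.2 fun j => ?_
  have h1 : ContinuousOn (fun t => A.chartDeriv I φ s x₀ t (stdBasis m j))
    (A.chartDomain (H := H) φ s x₀) := hD.clm_apply continuousOn_const
  exact (EuclideanSpace.proj i : Coord m →L[ℝ] ℝ).continuous.comp_continuousOn h1

lemma IsOrientedDiffeo.continuousOn_inv_chartMatrix (s : A.Facet) (x₀ : M) (i j : Fin m) :
    ContinuousOn (fun t => (A.chartMatrix I φ s x₀ t)⁻¹ i j)
      (A.chartDomain (H := H) φ s x₀) := by
  have hc := hφ.continuousOn_chartMatrix s x₀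
  have h1 := (continuous_id.matrix_det).comp_continuousOn hc
  have h2 := ((continuous_id.matrix_adjugate).matrix_elem i j).comp_continuousOn hc
  refine ((h1.inv₀ fun t ht => ?_).mul h2).congr fun t _ => ?_
  · simp only [Function.comp_apply, id_eq, det_chartMatrix]
    exact hφ.det_chartDeriv_ne_zero s x₀ (interior_subset ht.1) ht.2
  · simp [Matrix.inv_def]

lemma IsOrientedDiffeo.pullback_components (w : HodgeAdjoint.Form I M k) (s : A.Facet) (x₀ : M)
    {t : Coord m} (ht : t ∈ simplex m) (hx : A.localMap φ s t ∈ (chartAt H x₀).source) :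
    (fun J : Fin k → Fin m => A.pullback I φ w s t (stdBasis m ∘ J)) =
      (tensorPower k (A.chartMatrix I φ s x₀ t)).transpose.mulVec fun K =>
        w ((extChartAt I x₀).symm (A.chartMap I φ s x₀ t))
          (coordFrame I x₀ (A.chartMap I φ s x₀ t) ∘ K) := by
  classical
  let y := A.chartMap I φ s x₀ t
  let F : Coord m →L[ℝ] Coord m := mfderivWithin 𝓘(ℝ, Coord m) I (extChartAt I x₀).symm (range I) y
  let p : MultilinearMap ℝ (fun _ : Fin k => Coord m) ℝ :=
    (w ((extChartAt I x₀).symm y)).toMultilinearMap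
  have hw (z : M) (hz : z = A.localMap φ s t) (v : Fin k → Coord m) :
      w z v = w (A.localMap φ s t) v := by
    subst hz; rfl
  funext J
  have h1 : A.pullback I φ w s t (stdBasis m ∘ J) =
      p fun a => ∑ i, A.chartMatrix I φ s x₀ t i (J a) • F (stdBasis m i) := by
    refine Eq.trans ?_ (hw _ (symm_chartMap (I := I) s x₀ hx) _).symm
    rw [pullback, AlternatingMap.compLinearMap_apply]
    congr 1
    funext a
    refine (hφ.tangentMap_eq s x₀ ht hx (stdBasis m (J a))).trans ?_
    have h2 := congrArg F (sum_coord_smul_stdBasis (A.chartDeriv I φ s x₀ t (stdBasis m (J a))))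
    rw [map_sum] at h2
    simp only [map_smul] at h2
    exact h2.symm
  rw [h1, p.map_sum]
  simp only [p.map_smul_univ, Matrix.mulVec, dotProduct, Matrix.transpose_apply, tensorPower,
    Matrix.of_apply, smul_eq_mul]
  rfl

lemma IsOrientedDiffeo.components_eq (w : HodgeAdjoint.Form I M k) (s : A.Facet) (x₀ : M)
    {t : Coord m} (ht : t ∈ simplex m) (hx : A.localMap φ s t ∈ (chartAt H x₀).source) :
    (fun K : Fin k → Fin m => w ((extChartAt I x₀).symm (A.chartMap I φ s x₀ t))
          (coordFrame I x₀ (A.chartMap I φ s x₀ t) ∘ K)) =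
      (tensorPower k (A.chartMatrix I φ s x₀ t)⁻¹).transpose.mulVec fun J =>
        A.pullback I φ w s t (stdBasis m ∘ J) := by
  have hdet : IsUnit (A.chartMatrix I φ s x₀ t).det := by
    rw [det_chartMatrix]
    exact (hφ.det_chartDeriv_ne_zero s x₀ ht hx).isUnit
  rw [hφ.pullback_components w s x₀ ht hx, Matrix.mulVec_mulVec, ← Matrix.transpose_mul,
    ← tensorPower_mul, Matrix.mul_nonsing_inv _ hdet, tensorPower_one, Matrix.transpose_one,
    Matrix.one_mulVec]

/-- Measurability is checked on the finitely many chart domains of a cover of `M`, after discarding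
the boundary of the simplex. There the components are combinations of chart components with
continuous coefficients. -/
lemma IsOrientedDiffeo.hasMeasurableComponents_pullback [CompactSpace M]
    {w : HodgeAdjoint.Form I M k} (hw : IsMeasurableForm I w) (s : A.Facet) :
    HasMeasurableComponents (A.pullback I φ w s) := by
  intro J
  obtain ⟨T, hT⟩ := isCompact_univ.elim_finite_subcover (fun x : M => (chartAt H x).source)
    (fun x => (chartAt H x).open_source) (fun x _ => mem_iUnion.2 ⟨x, mem_chart_source H x⟩)
  rw [← Measure.restrict_congr_set (interior_simplex_ae_eq m)]
  have hcover : interior (simplex m) ⊆ ⋃ x : T, A.chartDomain (H := H) φ s (x : M) := by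
    intro t ht
    obtain ⟨x, hx, hxt⟩ := mem_iUnion₂.1 (hT (mem_univ (A.localMap φ s t)))
    exact mem_iUnion.2 ⟨⟨x, hx⟩, ht, hxt⟩
  refine AEMeasurable.mono_set hcover (aemeasurable_iUnion_iff.2 fun x => ?_)
  have hopen := hφ.isOpen_chartDomain s (x : M)
  have hsub : A.chartMap I φ s x '' A.chartDomain (H := H) φ s (x : M) ⊆
      (extChartAt I (x : M)).target := by
    rintro _ ⟨t, ht, rfl⟩
    exact chartMap_mem_target s _ ht.2
  have hmeas (K : Fin k → Fin m) := (aemeasurable_image_iff hopen.measurableSet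
    (hφ.hasFDerivWithinAt_chartDomain s (x : M) subset_rfl) (hφ.injOn_chartDomain s (x : M))
    (fun t ht => hφ.det_chartDeriv_ne_zero s (x : M) (interior_subset ht.1) ht.2) _).1
    ((hw x K).mono_set hsub)
  have hcont := hφ.continuousOn_chartMatrix s (x : M)
  have hent (i j : Fin m) : AEMeasurable (fun t => A.chartMatrix I φ s (x : M) t i j)
      (volume.restrict (A.chartDomain (H := H) φ s (x : M))) :=
    (((continuous_id.matrix_elem i j).comp_continuousOn hcont)).aemeasurable hopen.measurableSet
  refine AEMeasurable.congr (f := fun t => ∑ K : Fin k → Fin m,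
    (∏ a, A.chartMatrix I φ s (x : M) t (K a) (J a)) *
      w ((extChartAt I (x : M)).symm (A.chartMap I φ s (x : M) t))
          (coordFrame I (x : M) (A.chartMap I φ s (x : M) t) ∘ K)) ?_ ?_
  · exact Finset.aemeasurable_fun_sum _ fun K _ =>
      (Finset.aemeasurable_fun_prod _ fun a _ => hent _ _).mul (hmeas K)
  · filter_upwards [ae_restrict_mem hopen.measurableSet] with t ht
    exact (congrFun (hφ.pullback_components w s (x : M) (interior_subset ht.1) ht.2) J).symm

/-- On the images of the open simplices, which fill the chart target up to a null set, the
components are those of `σ` transformed by the inverse Jacobian matrix. -/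
lemma IsOrientedDiffeo.isMeasurableForm_pushforward {σ : A.Form k}
    (hσ : ∀ s, HasMeasurableComponents (σ s)) : IsMeasurableForm I (A.pushforward I φ σ) := by
  intro x J
  refine AEMeasurable.mono_measure ?_ (Measure.restrict_mono_ae (hφ.target_ae_le x))
  refine aemeasurable_iUnion_iff.2 fun s => ?_
  have hopen := hφ.isOpen_chartDomain s x
  rw [aemeasurable_image_iff hopen.measurableSet
    (hφ.hasFDerivWithinAt_chartDomain s x subset_rfl) (hφ.injOn_chartDomain s x)
    (fun t ht => hφ.det_chartDeriv_ne_zero s x (interior_subset ht.1) ht.2)]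
  have hent (i j : Fin m) : AEMeasurable (fun t => (A.chartMatrix I φ s x t)⁻¹ i j)
      (volume.restrict (A.chartDomain (H := H) φ s x)) :=
    (hφ.continuousOn_inv_chartMatrix s x i j).aemeasurable hopen.measurableSet
  refine AEMeasurable.congr (f := fun t => ∑ K : Fin k → Fin m,
    (∏ a, (A.chartMatrix I φ s x t)⁻¹ (K a) (J a)) * σ s t (stdBasis m ∘ K)) ?_ ?_
  · exact Finset.aemeasurable_fun_sum _ fun K _ =>
      (Finset.aemeasurable_fun_prod _ fun a _ => hent _ _).mul
        ((hσ s K).mono_set fun t ht => interior_subset ht.1)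
  · filter_upwards [ae_restrict_mem hopen.measurableSet] with t ht
    have h := congrFun (hφ.components_eq (A.pushforward I φ σ) s x (interior_subset ht.1) ht.2) J
    rw [hφ.pullback_pushforward σ s ht.1] at h
    exact h.symm

end Measurability

end PolygonalSpace

/-! ### The `L²` inner product and the adjoint formula -/

namespace PolygonalSpace

variable {m k l : ℕ} {V : Type*} [AddCommGroup V] [Module ℝ V] {A : PolygonalSpace m V}
  {H : Type*} [TopologicalSpace H] {I : ModelWithCorners ℝ (Coord m) H}
  {M : Type*} [TopologicalSpace M] [ChartedSpace H M] {φ : V → M}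

lemma ae_mem_interior_simplex (B : Coord m → Coord m → Coord m → ℝ) :
    ∀ᵐ t ∂(fieldVolume B), t ∈ interior (simplex m) := by
  rw [← fieldVolume_restrict_interior B]
  exact ae_restrict_mem isOpen_interior.measurableSet

section L2

lemma hasMeasurableComponents_sub {u v : Coord m → Coord m [⋀^Fin k]→ₗ[ℝ] ℝ}
    (hu : HasMeasurableComponents u) (hv : HasMeasurableComponents v) :
    HasMeasurableComponents (u - v) := fun J => (hu J).sub (hv J)

lemma MemL2.integrable_pointwiseInner {u v : A.Form k} (hu : A.MemL2 u) (hv : A.MemL2 v)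
    (s : A.Facet) : Integrable (A.pointwiseInner u v s) (A.facetVolume s) :=
  (isMetricField_metricAt s).integrable_formInner (hu s).1 (hv s).1 (hu s).2 (hv s).2

lemma MemL2.sub {u v : A.Form k} (hu : A.MemL2 u) (hv : A.MemL2 v) : A.MemL2 (u - v) := by
  intro s
  refine ⟨hasMeasurableComponents_sub (hu s).1 (hv s).1, ?_⟩
  refine (((hu.integrable_pointwiseInner hu s).sub (hu.integrable_pointwiseInner hv s)).sub
    ((hv.integrable_pointwiseInner hu s).sub (hv.integrable_pointwiseInner hv s))).congr
    (Eventually.of_forall fun t => ?_)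
  simp only [pointwiseInner, Pi.sub_apply, formInner_sub_left, formInner_sub_right]
  ring

lemma MemL2.l2Inner_sub_left {u v w : A.Form k} (hu : A.MemL2 u) (hv : A.MemL2 v)
    (hw : A.MemL2 w) : A.l2Inner (u - v) w = A.l2Inner u w - A.l2Inner v w := by
  simp only [l2Inner]
  rw [← Finset.sum_sub_distrib]
  refine Finset.sum_congr rfl fun s _ => ?_
  rw [← integral_sub (hu.integrable_pointwiseInner hw s) (hv.integrable_pointwiseInner hw s)]
  simp only [pointwiseInner, Pi.sub_apply, formInner_sub_left]

lemma pointwiseInner_self_nonneg_ae (u : A.Form k) (s : A.Facet) :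
    ∀ᵐ t ∂(A.facetVolume s), 0 ≤ A.pointwiseInner u u s t := by
  filter_upwards [ae_mem_interior_simplex (A.metricAt s)] with t ht
  exact formInner_self_nonneg (posDef_gram_metricAt s (interior_subset ht)) _

/-- A form of norm zero vanishes almost everywhere. -/
lemma MemL2.ae_eq_zero {u : A.Form k} (hu : A.MemL2 u) (h : A.l2Inner u u = 0) (s : A.Facet) :
    u s =ᵐ[A.facetVolume s] 0 := by
  have h1 := (Finset.sum_eq_zero_iff_of_nonneg fun s _ =>
    integral_nonneg_of_ae (pointwiseInner_self_nonneg_ae u s)).1 h s (Finset.mem_univ s)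
  rw [integral_eq_zero_iff_of_nonneg_ae (pointwiseInner_self_nonneg_ae u s) (hu s).2] at h1
  filter_upwards [h1, ae_mem_interior_simplex (A.metricAt s)] with t ht ht'
  exact formInner_self_eq_zero (posDef_gram_metricAt s (interior_subset ht')) ht

end L2

variable {o : ∀ x : M, Orientation ℝ (TangentSpace I x) (Fin m)}
  (hφ : A.IsOrientedDiffeo I φ o) [IsManifold I ∞ M]
  (g : ContMDiffRiemannianMetric I ∞ (Coord m) (fun x : M => TangentSpace I x))

include hφ

lemma IsOrientedDiffeo.pointwiseInner_ae_eq (u v : HodgeAdjoint.Form I M k) (s : A.Facet) :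
    (fun t => HodgeAdjoint.pointwiseInner I g u v (A.localMap φ s t))
      =ᵐ[fieldVolume (A.pullMetric I φ g s)] fun t => formInner (stdBasis m)
        (A.pullMetric I φ g s t) (A.pullback I φ u s t) (A.pullback I φ v s t) := by
  filter_upwards [ae_mem_interior_simplex (A.pullMetric I φ g s)] with t ht
  exact hφ.pointwiseInner_localMap g u v s (interior_subset ht)

lemma IsOrientedDiffeo.pullback_pushforward_ae_eq (σ : A.Form k) (s : A.Facet) :
    A.pullback I φ (A.pushforward I φ σ) s =ᵐ[fieldVolume (A.pullMetric I φ g s)] σ s := by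
  filter_upwards [ae_mem_interior_simplex (A.pullMetric I φ g s)] with t ht
  exact hφ.pullback_pushforward σ s ht

lemma IsOrientedDiffeo.integrable_formInner_pullMetric {σ : A.Form k} (hσ : A.MemL2 σ)
    (s : A.Facet) : Integrable (fun t => formInner (stdBasis m) (A.pullMetric I φ g s t)
      (σ s t) (σ s t)) (fieldVolume (A.pullMetric I φ g s)) := by
  have hA := isMetricField_metricAt s
  have hP := hφ.isMetricField_pullMetric g s
  obtain ⟨C, -, hC⟩ := hA.exists_formInner_le hP k
  rw [hP.integrable_fieldVolume_iff]
  refine ((hA.integrable_fieldVolume_iff.1 (hσ s).2).const_mul C).mono'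
    ((hP.aemeasurable_formInner (hσ s).1 (hσ s).1).mul
      hP.aemeasurable_density).aestronglyMeasurable ?_
  filter_upwards [ae_restrict_mem (measurableSet_simplex m)] with t ht
  rw [Real.norm_of_nonneg (mul_nonneg (formInner_self_nonneg (hP.posDef t ht) _)
    (hP.density_pos ht).le)]
  exact hC t ht (σ s t)

/-- The pointwise form of the adjoint formula. -/
lemma IsOrientedDiffeo.pointwiseInner_star_pullback_star (h : k + l = m) (h' : l + k = m)
    (τ : HodgeAdjoint.Form I M k) (σ : A.Form k) (s : A.Facet) {t : Coord m}
    (ht : t ∈ simplex m) :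
    A.pointwiseInner ((-1 : ℝ) ^ (k * l) •
        A.star h' (A.pullback I φ (HodgeAdjoint.star I g o h τ))) σ s t *
      density (A.metricAt s) t =
    formInner (stdBasis m) (A.pullMetric I φ g s t) (A.pullback I φ τ s t) (σ s t) *
      density (A.pullMetric I φ g s) t := by
  have key := formInner_hodgeStar_hodgeStar (stdBasis m) (A.metricAt s t)
    (A.pullMetric I φ g s t) (posDef_gram_metricAt s ht) (A.orientation s) h h'
    (A.pullback I φ τ s t) (σ s t)
  rw [← hφ.pullback_star g h τ s ht] at key
  exact key

variable [CompactSpace M] [T2Space M] [MeasurableSpace M] [BorelSpace M]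

lemma IsOrientedDiffeo.memL2_pushforward {σ : A.Form k} (hσ : A.MemL2 σ) :
    HodgeAdjoint.MemL2 I g (A.pushforward I φ σ) := by
  refine ⟨hφ.isMeasurableForm_pushforward fun s => (hσ s).1, ?_⟩
  rw [hφ.integrable_riemannianVolume_iff g]
  intro s
  refine (hφ.integrable_formInner_pullMetric g hσ s).congr ?_
  filter_upwards [hφ.pointwiseInner_ae_eq g (A.pushforward I φ σ) (A.pushforward I φ σ) s,
    hφ.pullback_pushforward_ae_eq g σ s] with t h1 h2
  rw [h1, h2]

lemma IsOrientedDiffeo.memL2_pullback {τ : HodgeAdjoint.Form I M k}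
    (hτ : HodgeAdjoint.MemL2 I g τ) (s : A.Facet) :
    Integrable (fun t => formInner (stdBasis m) (A.pullMetric I φ g s t)
      (A.pullback I φ τ s t) (A.pullback I φ τ s t)) (fieldVolume (A.pullMetric I φ g s)) :=
  ((hφ.integrable_riemannianVolume_iff g).1 hτ.2 s).congr (hφ.pointwiseInner_ae_eq g τ τ s)

/-- The inner product of a form with a push-forward, as a sum of integrals over the facets. -/
lemma IsOrientedDiffeo.l2Inner_pushforward {τ : HodgeAdjoint.Form I M k}
    (hτ : HodgeAdjoint.MemL2 I g τ) {σ : A.Form k} (hσ : A.MemL2 σ) :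
    HodgeAdjoint.l2Inner I g τ (A.pushforward I φ σ) =
      ∑ s, ∫ t in simplex m, formInner (stdBasis m) (A.pullMetric I φ g s t)
        (A.pullback I φ τ s t) (σ s t) * density (A.pullMetric I φ g s) t := by
  have hae (s : A.Facet) : (fun t => HodgeAdjoint.pointwiseInner I g τ (A.pushforward I φ σ)
      (A.localMap φ s t)) =ᵐ[fieldVolume (A.pullMetric I φ g s)] fun t =>
        formInner (stdBasis m) (A.pullMetric I φ g s t) (A.pullback I φ τ s t) (σ s t) := by
    filter_upwards [hφ.pointwiseInner_ae_eq g τ (A.pushforward I φ σ) s,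
      hφ.pullback_pushforward_ae_eq g σ s] with t h1 h2
    rw [h1, h2]
  have hint : Integrable (HodgeAdjoint.pointwiseInner I g τ (A.pushforward I φ σ))
      (riemannianVolume I g) := by
    rw [hφ.integrable_riemannianVolume_iff g]
    intro s
    exact ((hφ.isMetricField_pullMetric g s).integrable_formInner
      (hφ.hasMeasurableComponents_pullback hτ.1 s) (hσ s).1 (hφ.memL2_pullback g hτ s)
      (hφ.integrable_formInner_pullMetric g hσ s)).congr (hae s).symm
  rw [HodgeAdjoint.l2Inner, hφ.integral_riemannianVolume g hint]
  refine Finset.sum_congr rfl fun s _ => ?_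
  rw [integral_congr_ae (hae s), (hφ.isMetricField_pullMetric g s).integral_fieldVolume]

lemma IsOrientedDiffeo.exists_l2Inner_pushforward_le (k : ℕ) : ∃ C : ℝ, ∀ σ : A.Form k,
    A.MemL2 σ → HodgeAdjoint.l2Inner I g (A.pushforward I φ σ) (A.pushforward I φ σ) ≤
      C * A.l2Inner σ σ := by
  choose C hC0 hC using fun s => (isMetricField_metricAt (A := A) s).exists_formInner_le
    (hφ.isMetricField_pullMetric g s) k
  -- The facet constants are positive, so their finite sum dominates each of them.
  refine ⟨∑ s, C s, fun σ hσ => ?_⟩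
  rw [hφ.l2Inner_pushforward g (hφ.memL2_pushforward g hσ) hσ, l2Inner, Finset.mul_sum]
  refine Finset.sum_le_sum fun s _ => ?_
  have hA := isMetricField_metricAt s
  have hP := hφ.isMetricField_pullMetric g s
  have hle : C s ≤ ∑ s, C s := Finset.single_le_sum (fun s _ => (hC0 s).le) (Finset.mem_univ s)
  refine le_trans ?_ (mul_le_mul_of_nonneg_right hle
    (integral_nonneg_of_ae (pointwiseInner_self_nonneg_ae σ s)))
  have e : ∫ t, A.pointwiseInner σ σ s t ∂(A.facetVolume s) = ∫ t in simplex m,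
      formInner (stdBasis m) (A.metricAt s t) (σ s t) (σ s t) * density (A.metricAt s) t :=
    hA.integral_fieldVolume _
  have e2 : ∫ t in simplex m, formInner (stdBasis m) (A.pullMetric I φ g s t)
      (A.pullback I φ (A.pushforward I φ σ) s t) (σ s t) * density (A.pullMetric I φ g s) t =
      ∫ t in simplex m, formInner (stdBasis m) (A.pullMetric I φ g s t)
        (σ s t) (σ s t) * density (A.pullMetric I φ g s) t := by
    refine integral_congr_ae ?_
    filter_upwards [hP.ae_fieldVolume_iff.1 (hφ.pullback_pushforward_ae_eq g σ s)] with t ht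
    rw [ht]
  rw [e, e2, ← integral_const_mul]
  refine setIntegral_mono_on
    (hP.integrable_fieldVolume_iff.1 (hφ.integrable_formInner_pullMetric g hσ s))
    ((hA.integrable_fieldVolume_iff.1 (hσ s).2).const_mul _) (measurableSet_simplex m)
    fun t ht => hC s t ht _

/-- No norm of a star is computed. Testing the pointwise adjoint identity on the candidate `ρ`
itself gives `|ρ|_A² = ⟪φ^*τ, ρ⟫_P` with densities included, and the comparison `|ρ|_P² ≤ C |ρ|_A²`
then yields `|ρ|_A² ≤ C |φ^*τ|_P²`. -/
lemma IsOrientedDiffeo.memL2_star_pullback_star (h : k + l = m) (h' : l + k = m)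
    {τ : HodgeAdjoint.Form I M k} (hτ : HodgeAdjoint.MemL2 I g τ) :
    A.MemL2 ((-1 : ℝ) ^ (k * l) •
      A.star h' (A.pullback I φ (HodgeAdjoint.star I g o h τ))) := by
  intro s
  set ρ := (-1 : ℝ) ^ (k * l) • A.star h' (A.pullback I φ (HodgeAdjoint.star I g o h τ)) with hρ
  have hA := isMetricField_metricAt s
  have hP := hφ.isMetricField_pullMetric g s
  have hm : HasMeasurableComponents (ρ s) := by
    have h1 := hA.hasMeasurableComponents_hodgeStar (hP.hasMeasurableComponents_hodgeStar
      (hφ.hasMeasurableComponents_pullback hτ.1 s) (A.orientation s) h) (A.orientation s) h'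
    intro J
    refine ((h1 J).const_mul ((-1 : ℝ) ^ (k * l))).congr ?_
    filter_upwards [ae_restrict_mem (measurableSet_simplex m)] with t ht
    rw [← hφ.pullback_star g h τ s ht]
    rfl
  refine ⟨hm, ?_⟩
  obtain ⟨C, hC0, hC⟩ := hA.exists_formInner_le hP k
  have hint := (hP.integrable_fieldVolume_iff.1 (hφ.memL2_pullback g hτ s)).const_mul C
  refine hA.integrable_fieldVolume_iff.2 (hint.mono'
    ((hA.aemeasurable_formInner hm hm).mul hA.aemeasurable_density).aestronglyMeasurable ?_)
  filter_upwards [ae_restrict_mem (measurableSet_simplex m)] with t ht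
  simp only [pointwiseInner]
  rw [Real.norm_of_nonneg (mul_nonneg (formInner_self_nonneg (hA.posDef t ht) _)
    (hA.density_pos ht).le)]
  have h1 := hφ.pointwiseInner_star_pullback_star g h h' τ ρ s ht
  rw [← hρ] at h1
  simp only [pointwiseInner] at h1
  have h2 := hC t ht (ρ s t)
  -- The scaling by `C` makes `2C |ρ|_A² ≤ C² |φ^*τ|_P² + |ρ|_P²`, where the last term is at most `C
  -- |ρ|_A²` and is absorbed on the left.
  have h3 := mul_le_mul_of_nonneg_right
    (two_mul_formInner_le (hP.posDef t ht) (C • A.pullback I φ τ s t) (ρ s t))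
    (hP.density_pos ht).le
  rw [formInner_smul_left, formInner_smul_left, formInner_smul_right] at h3
  refine le_of_mul_le_mul_left ?_ hC0
  linear_combination h2 + h3 + 2 * C * h1

/-- The adjoint of the push-forward is `(-1) ^ (k l) ⋆ φ^* ⋆`. -/
lemma IsOrientedDiffeo.isAdjointImage_star_pullback_star (h : k + l = m) (h' : l + k = m)
    {τ : HodgeAdjoint.Form I M k} (hτ : HodgeAdjoint.MemL2 I g τ) :
    A.IsAdjointImage I φ g τ ((-1 : ℝ) ^ (k * l) •
      A.star h' (A.pullback I φ (HodgeAdjoint.star I g o h τ))) := by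
  refine ⟨hφ.memL2_star_pullback_star g h h' hτ, fun σ hσ => ?_⟩
  rw [hφ.l2Inner_pushforward g hτ hσ, l2Inner]
  refine Finset.sum_congr rfl fun s _ => ?_
  refine ((isMetricField_metricAt s).integral_fieldVolume _).trans ?_
  exact setIntegral_congr_fun (measurableSet_simplex m) fun t ht =>
    hφ.pointwiseInner_star_pullback_star g h h' τ σ s ht

-- The difference of the two representatives is itself in `L²`; testing both identities against it
-- shows that its norm is zero.
omit hφ [CompactSpace M] [T2Space M] [BorelSpace M] in
lemma IsAdjointImage.aeEq {τ : HodgeAdjoint.Form I M k} {ρ ρ' : A.Form k}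
    (hρ : A.IsAdjointImage I φ g τ ρ) (hρ' : A.IsAdjointImage I φ g τ ρ') : A.AEEq ρ ρ' := by
  have hsub := hρ.1.sub hρ'.1
  have h0 : A.l2Inner (ρ - ρ') (ρ - ρ') = 0 := by
    rw [hρ.1.l2Inner_sub_left hρ'.1 hsub, hρ.2 _ hsub, hρ'.2 _ hsub, sub_self]
  intro s
  filter_upwards [hsub.ae_eq_zero h0 s] with t ht
  exact sub_eq_zero.1 ht

end PolygonalSpace

end HodgeAdjoint

end

theorem mainTheorem11 {m k : ℕ} (hk : k ≤ m)
    {H : Type*} [TopologicalSpace H]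
    (I : ModelWithCorners ℝ (EuclideanSpace ℝ (Fin m)) H)
    {M : Type*} [TopologicalSpace M] [ChartedSpace H M] [IsManifold I ∞ M]
    [CompactSpace M] [T2Space M] [MeasurableSpace M] [BorelSpace M]
    (g : ContMDiffRiemannianMetric I ∞ (EuclideanSpace ℝ (Fin m)) (fun x : M => TangentSpace I x))
    (o : ∀ x : M, Orientation ℝ (TangentSpace I x) (Fin m))
    (ho : HodgeAdjoint.IsContinuousOrientation I o)
    {V : Type*} [AddCommGroup V] [Module ℝ V]
    (A : HodgeAdjoint.PolygonalSpace m V)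
    (φ : V → M) (hφ : A.IsOrientedDiffeo I φ o) :
    -- the push-forward is a bounded operator from `L²Ωᵏ(M_A)` to `L²Ωᵏ(M)`
    (∃ C : ℝ, ∀ σ : A.Form k, A.MemL2 σ →
      HodgeAdjoint.MemL2 I g (A.pushforward I φ σ) ∧
      HodgeAdjoint.l2Inner I g (A.pushforward I φ σ) (A.pushforward I φ σ) ≤ C * A.l2Inner σ σ) ∧
    -- `(-1) ^ (k (m - k)) ⋆ π_A ⋆ τ` is in `L²Ωᵏ(M_A)` and is the image of `τ` under the adjoint of
    -- the push-forward; any other representative of that image agrees with it almost everywhere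
    (∀ τ : HodgeAdjoint.Form I M k, HodgeAdjoint.MemL2 I g τ →
      A.IsAdjointImage I φ g τ ((-1 : ℝ) ^ (k * (m - k)) •
        A.star (Nat.sub_add_cancel hk)
          (A.pullback I φ (HodgeAdjoint.star I g o (Nat.add_sub_cancel' hk) τ))) ∧
      ∀ ρ : A.Form k, A.IsAdjointImage I φ g τ ρ →
        A.AEEq ρ ((-1 : ℝ) ^ (k * (m - k)) •
          A.star (Nat.sub_add_cancel hk)
            (A.pullback I φ (HodgeAdjoint.star I g o (Nat.add_sub_cancel' hk) τ)))) := by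
  obtain ⟨C, hC⟩ := hφ.exists_l2Inner_pushforward_le g k
  exact ⟨⟨C, fun σ hσ => ⟨hφ.memL2_pushforward g hσ, hC σ hσ⟩⟩, fun τ hτ =>
    ⟨hφ.isAdjointImage_star_pullback_star g _ _ hτ, fun ρ hρ =>
      HodgeAdjoint.PolygonalSpace.IsAdjointImage.aeEq g hρ
        (hφ.isAdjointImage_star_pullback_star g _ _ hτ)⟩⟩
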